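/- Let $k\ge 3$ be an integer, let $\mathrm{Po}(\lambda)$ denote a Poisson variable with mean $\lambda$, let $d_k=\inf\{\lambda/\Pr[\mathrm{Po}(\lambda)\ge k-1]:\lambda>0\}$ and let $d>d_k$. Let $p^*$ be the largest fixed point of $\phi_{d,k}:[0,1]\to[0,1]$, $p\mapsto \Pr[\mathrm{Po}(dp)\ge k-1]$. Write $\mathrm{Po}_{\ge z}(\lambda)$, $\mathrm{Po}_{<z}(\lambda)$ for $\mathrm{Po}(\lambda)$ conditioned on being at least $z$, respectively less than $z$. For a finite set $\mathcal X$, a rooted $\mathcal X$-marked graph is a connected locally finite graph on a countable vertex set with a distinguished root and a mark in $\mathcal X$ on every vertex. Let $[\,\cdot\,]$ denote its isomorphism class (isomorphisms preserve the root and the marks) and $\partial^s$ the deletion of all vertices at distance greater than $s$ from the root. The set of isomorphism classes carries the coarsest topology that makes all the maps $\Gamma'\mapsto \mathbf 1\{\partial^s\Gamma'=\partial^s\Gamma\}$ ($s\ge 0$, $\Gamma$ an isomorphism class) continuous, and its Borel $\sigma$-algebra; $\mathcal L$ denotes the distribution of a random isomorphism class. *The tree $\hat T^*(d,k)$.* Let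 $T^*(d,k)$ be the random tree generated by the following two-type branching process. The root $v_0$ has type $1$ with probability $p^*$ and type $0$ with probability $1-p^*$. A vertex of type $0$ has $\mathrm{Po}(d(1-p^*))$ children of type $0$ and independently $\mathrm{Po}_{<k-1}(dp^*)$ children of type $1$; a vertex of type $1$ has $\mathrm{Po}(d(1-p^*))$ children of type $0$ and independently $\mathrm{Po}_{\ge k-1}(dp^*)$ children of type $1$. Let $\mu^*_{v\uparrow}$ be the type of $v$ and let $\partial_+v$ be the set of children of $v$. Put $\mu^*_{\downarrow v_0}=0$, for $v\ne v_0$ with parent $u$ put recursively $$\mu^*_{\downarrow v}=\mathbf 1\Big\{\mu^*_{\downarrow u}+\sum_{w\in\partial_+u\setminus\{v\}}\mu^*_{w\uparrow}\ge k-1\Big\},$$ and for every vertex $v$ put $$\mu^*_v=\mathbf 1\Big\{\mu^*_{\downarrow v}+\sum_{w\in\partial_+v}\mu^*_{w\uparrow}\ge k\Big\}.$$ Let $\hat T^*(d,k)$ be the tree $T^*(d,k)$ in which every vertex $v$ is marked by the triple $(\mu^*_v,\mu^*_{v\uparrow},\mu^*_{\downarrow v})\in\{0,1\}^3$. *The tree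 $\hat T(d,k,p)$.* For $p\in(0,1]$ let $q=\Pr[\mathrm{Po}(dp)=k-1\mid \mathrm{Po}(dp)\ge k-1]$ and $\bar q=\Pr[\mathrm{Po}(dp)=k-2\mid \mathrm{Po}(dp)\le k-2]$. Consider the branching process with the five types $000,001,010,110,111$ whose root has type $000$, $010$, $110$ with probability $1-p$, $pq$, $p(1-q)$, respectively, and in which a vertex of type $z$ has the offspring vector $y=(y_{000},y_{001},y_{010},y_{110},y_{111})$ with probability equal to the coefficient of $x_{000}^{y_{000}}x_{001}^{y_{001}}x_{010}^{y_{010}}x_{110}^{y_{110}}x_{111}^{y_{111}}$ in $g_z$, where, with $m=qx_{010}+(1-q)x_{110}$ and $E_z=\exp(d(1-p)(x_z-1))$, $$g_{000}=E_{000}\,\frac{\sum_{h=0}^{k-2}(dp)^hm^h/h!}{\sum_{h=0}^{k-2}(dp)^h/h!},\qquad g_{001}=\bar q\,E_{001}\,m^{k-2}+(1-\bar q)\,E_{000}\,\frac{\sum_{h=0}^{k-3}(dp)^hm^h/h!}{\sum_{h=0}^{k-3}(dp)^h/h!},$$ $$g_{010}=E_{001}\,m^{k-1},\qquad g_{110}=E_{001}\,\frac{\sum_{h\ge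 k}(dp\,x_{111})^h/h!}{\sum_{h\ge k}(dp)^h/h!},\qquad g_{111}=E_{001}\,\frac{\sum_{h\ge k-1}(dp\,x_{111})^h/h!}{\sum_{h\ge k-1}(dp)^h/h!}.$$ Let $\hat T(d,k,p)$ be the resulting random tree, each vertex being marked by its type, viewed as an element of $\{0,1\}^3$. **Claim.** For $p=p^*$ all the root and offspring distributions above are well-defined probability distributions, and $$\mathcal L([\hat T^*(d,k)])=\mathcal L([\hat T(d,k,p^*)]).$$ -/

import Mathlib

open MeasureTheory ProbabilityTheory

noncomputable section

/-! ### Rooted marked graphs and their isomorphism classes -/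

/-- A rooted `Y`-marked graph: a connected locally finite graph on a countable vertex set, with a
distinguished root and a mark in `Y` on every vertex. -/
structure RootedMarkedGraph (Y : Type) where
  /-- the vertex set -/
  V : Type
  countable : Countable V
  /-- the graph -/
  G : SimpleGraph V
  connected : G.Connected
  locallyFinite : ∀ v, (G.neighborSet v).Finite
  /-- the root -/
  root : V
  /-- the marks -/
  mark : V → Y

namespace RootedMarkedGraph

variable {Y : Type}

/-- Two rooted marked graphs are isomorphic if there is a graph isomorphism that maps root to root
and preserves the marks. -/
def Isomorphic (A B : RootedMarkedGraph Y) : Prop :=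
  ∃ e : A.G ≃g B.G, e A.root = B.root ∧ ∀ v, A.mark v = B.mark (e v)

/-- Isomorphism of rooted marked graphs as a setoid. -/
instance isoSetoid (Y : Type) : Setoid (RootedMarkedGraph Y) where
  r := Isomorphic
  iseqv :=
    { refl := fun _ => ⟨SimpleGraph.Iso.refl, rfl, fun _ => rfl⟩
      symm := by
        rintro A B ⟨e, h, hm⟩
        refine ⟨e.symm, ?_, fun v => ?_⟩
        · rw [← h]; exact e.symm_apply_apply _
        · rw [hm]; exact congrArg B.mark (e.apply_symm_apply v).symm
      trans := by
        rintro A B C ⟨e, h, hm⟩ ⟨f, h', hm'⟩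
        refine ⟨e.trans f, ?_, fun v => ?_⟩
        · rw [← h', ← h]; rfl
        · rw [hm, hm']; rfl }

/-- The set of vertices at distance at most `s` from the root. -/
def ball (A : RootedMarkedGraph Y) (s : ℕ) : Set A.V := {v | A.G.dist A.root v ≤ s}

theorem root_mem_ball (A : RootedMarkedGraph Y) (s : ℕ) : A.root ∈ A.ball s := by
  simp [ball]

theorem induce_ball_connected (A : RootedMarkedGraph Y) (s : ℕ) :
    (A.G.induce (A.ball s)).Connected := by
  classical
  refine SimpleGraph.induce_connected_of_patches A.root (A.root_mem_ball s) ?_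
  intro v hv
  obtain ⟨p, hp⟩ := A.connected.exists_walk_length_eq_dist A.root v
  refine ⟨{x | x ∈ p.support}, ?_, p.start_mem_support, p.end_mem_support,
    p.connected_induce_support _ _⟩
  intro x hx
  have h1 : A.G.dist A.root x ≤ (p.takeUntil x hx).length := SimpleGraph.dist_le _
  have h2 := p.length_takeUntil_le_length hx
  have h3 : A.G.dist A.root v ≤ s := hv
  show A.G.dist A.root x ≤ s
  omega

/-- The rooted marked graph obtained by deleting all vertices at distance greater than `s` from
the root. -/
def truncate (s : ℕ) (A : RootedMarkedGraph Y) : RootedMarkedGraph Y where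
  V := A.ball s
  countable := by
    have := A.countable
    infer_instance
  G := A.G.induce (A.ball s)
  connected := A.induce_ball_connected s
  locallyFinite := fun v =>
    Set.Finite.of_finite_image
      ((A.locallyFinite v).subset (by rintro _ ⟨w, hw, rfl⟩; exact hw))
      (Set.injOn_of_injective Subtype.val_injective)
  root := ⟨A.root, A.root_mem_ball s⟩
  mark := fun v => A.mark v

theorem dist_le_of_iso {V W : Type} {G : SimpleGraph V} {H : SimpleGraph W} (hG : G.Connected)
    (e : G ≃g H) (u v : V) : H.dist (e u) (e v) ≤ G.dist u v := by
  obtain ⟨p, hp⟩ := hG.exists_walk_length_eq_dist u v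
  rw [← hp, ← SimpleGraph.Walk.length_map e.toHom p]
  exact SimpleGraph.dist_le _

theorem truncate_isomorphic (s : ℕ) {A B : RootedMarkedGraph Y} (h : A ≈ B) :
    truncate s A ≈ truncate s B := by
  obtain ⟨e, he, hm⟩ := h
  have key : ∀ v, e v ∈ B.ball s ↔ v ∈ A.ball s := by
    intro v
    have h1 := dist_le_of_iso A.connected e A.root v
    have h2 := dist_le_of_iso B.connected e.symm (e A.root) (e v)
    have h3 : e.symm (e A.root) = A.root := e.symm_apply_apply _
    have h4 : e.symm (e v) = v := e.symm_apply_apply _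
    rw [h3, h4] at h2
    show B.G.dist B.root (e v) ≤ s ↔ A.G.dist A.root v ≤ s
    rw [← he]
    omega
  refine ⟨⟨e.toEquiv.subtypeEquiv fun v => (key v).symm, ?_⟩, Subtype.ext he, fun v => hm v.1⟩
  intro a b
  exact e.map_rel_iff

end RootedMarkedGraph

/-- The set of isomorphism classes of rooted `Y`-marked graphs. -/
def MarkedGraphClass (Y : Type) : Type 1 := Quotient (RootedMarkedGraph.isoSetoid Y)

namespace MarkedGraphClass

variable {Y : Type}

/-- The isomorphism class of a rooted marked graph. -/
def mk (A : RootedMarkedGraph Y) : MarkedGraphClass Y := Quotient.mk _ A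

/-- The operation `∂ˢ` on isomorphism classes. -/
def truncate (s : ℕ) : MarkedGraphClass Y → MarkedGraphClass Y :=
  Quotient.map (RootedMarkedGraph.truncate s)
    fun _ _ h => RootedMarkedGraph.truncate_isomorphic s h

open Classical in
/-- The function `χ_{Γ,s}`: the indicator of `∂ˢ Γ' = ∂ˢ Γ`. -/
def chi (Γ : MarkedGraphClass Y) (s : ℕ) (Γ' : MarkedGraphClass Y) : Bool :=
  decide (truncate s Γ = truncate s Γ')

/-- The coarsest topology for which all the functions `χ_{Γ,s}` are continuous. -/
instance : TopologicalSpace (MarkedGraphClass Y) :=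
  ⨅ (Γ : MarkedGraphClass Y) (s : ℕ), TopologicalSpace.induced (chi Γ s) ⊥

/-- The Borel σ-algebra. -/
instance : MeasurableSpace (MarkedGraphClass Y) := borel _

instance : BorelSpace (MarkedGraphClass Y) := ⟨rfl⟩

end MarkedGraphClass

/-! ### Multi-type branching processes -/

/-- The potential vertices of a branching process with types in `X`: the root is `[]`, and
`(z, i) :: u` is the `i`-th child of type `z` of `u`. -/
abbrev Node (X : Type) : Type := List (X × ℕ)

/-- A sample of the randomness of a branching process: the type of the root and, for every potential
vertex `u` and every type `z`, the vector that counts the children of each type which `u` has if its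
type is `z`. -/
abbrev BranchingSample (X : Type) : Type := X × (Node X × X → X → ℕ)

/-- The law of the randomness of a branching process: the type of the root is distributed according
to `root`, the offspring vector of a vertex of type `z` is distributed according to `off z`, and all
these choices are independent. -/
def branchingLaw {X : Type} [MeasurableSpace X] (root : Measure X) (off : X → Measure (X → ℕ)) :
    Measure (BranchingSample X) :=
  root.prod (Measure.infinitePi fun i : Node X × X => off i.2)

namespace BranchingSample

variable {X : Type} (ω : BranchingSample X)

/-- The type of a vertex. -/
def type : Node X → X
  | [] => ω.1
  | a :: _ => a.1

/-- The number of children of each type of a vertex. -/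
def offspring (u : Node X) : X → ℕ := ω.2 (u, ω.type u)

/-- The potential vertices that are present in the tree. -/
def IsVertex : Node X → Prop
  | [] => True
  | a :: u => IsVertex u ∧ a.2 < ω.offspring u a.1

/-- The vertex set of the tree. -/
abbrev Vertex : Type := {u : Node X // ω.IsVertex u}

/-- The tree: every vertex is joined to its children. -/
def graph : SimpleGraph ω.Vertex where
  Adj u v := (∃ a, v.1 = a :: u.1) ∨ ∃ a, u.1 = a :: v.1
  symm := ⟨fun _ _ h => h.symm⟩
  loopless := ⟨fun u h => by
    rcases h with ⟨a, h⟩ | ⟨a, h⟩ <;> exact absurd (congrArg List.length h) (by simp)⟩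

/-- The root as a vertex. -/
def rootVertex : ω.Vertex := ⟨[], trivial⟩

theorem reachable_root : ∀ (u : Node X) (h : ω.IsVertex u),
    ω.graph.Reachable ω.rootVertex ⟨u, h⟩
  | [], _ => SimpleGraph.Reachable.refl _
  | a :: u, h => (reachable_root u h.1).trans
      (SimpleGraph.Adj.reachable (Or.inl ⟨a, rfl⟩))

theorem graph_connected : ω.graph.Connected := by
  rw [SimpleGraph.connected_iff_exists_forall_reachable]
  exact ⟨ω.rootVertex, fun v => ω.reachable_root v.1 v.2⟩

/-- The set of children of a vertex. -/
def children [Fintype X] [DecidableEq X] (u : Node X) : Finset (Node X) :=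
  (Finset.univ.sigma fun z : X => Finset.range (ω.offspring u z)).image fun a => (a.1, a.2) :: u

theorem mem_children [Fintype X] [DecidableEq X] (u : Node X) (a : X × ℕ) :
    a :: u ∈ ω.children u ↔ a.2 < ω.offspring u a.1 := by
  simp only [children, Finset.mem_image, Finset.mem_sigma, Finset.mem_univ, true_and,
    Finset.mem_range, List.cons.injEq, and_true]
  constructor
  · rintro ⟨b, hb, rfl⟩
    exact hb
  · exact fun h => ⟨⟨a.1, a.2⟩, h, rfl⟩

theorem neighborSet_finite [Fintype X] [DecidableEq X] (v : ω.Vertex) :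
    (ω.graph.neighborSet v).Finite := by
  refine Set.Finite.of_finite_image (f := Subtype.val) (Set.Finite.subset
    ((ω.children v.1).finite_toSet.union (Set.finite_singleton v.1.tail)) ?_)
    (Set.injOn_of_injective Subtype.val_injective)
  rintro _ ⟨⟨w, hw⟩, h, rfl⟩
  rcases h with ⟨a, h⟩ | ⟨a, h⟩
  · left
    simp only at h
    subst h
    exact (ω.mem_children v.1 a).2 hw.2
  · right
    simp [h]

/-- The rooted marked graph obtained from the tree by giving the mark `m u` to every vertex `u`. -/
def toMarkedGraph [Fintype X] [DecidableEq X] {Y : Type} (m : Node X → Y) :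
    RootedMarkedGraph Y where
  V := ω.Vertex
  countable := by infer_instance
  G := ω.graph
  connected := ω.graph_connected
  locallyFinite := ω.neighborSet_finite
  root := ω.rootVertex
  mark := fun v => m v.1

end BranchingSample

/-! ### Poisson variables, the threshold and the fixed point -/

/-- The Poisson distribution with mean `r ≥ 0`. -/
def po (r : ℝ) : Measure ℕ := poissonMeasure r.toNNReal

/-- `φ_{d,k}(p) = P[Po(dp) ≥ k - 1]`. -/
def phi (d : ℝ) (k : ℕ) (p : ℝ) : ℝ := (po (d * p)).real {n | k - 1 ≤ n}

/-- `d_k = inf {l / P[Po(l) ≥ k - 1] : l > 0}`. -/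
def coreThreshold (k : ℕ) : ℝ :=
  sInf ((fun l : ℝ => l / (po l).real {n | k - 1 ≤ n}) '' Set.Ioi 0)

/-- The largest fixed point of `φ_{d,k} : [0,1] → [0,1]`. -/
def pStar (d : ℝ) (k : ℕ) : ℝ := sSup {p | p ∈ Set.Icc (0 : ℝ) 1 ∧ phi d k p = p}

theorem phi_eq (d : ℝ) (k : ℕ) (p : ℝ) :
    phi d k p = 1 - ∑ n ∈ Finset.range (k - 1),
      Real.exp (-((d * p).toNNReal : ℝ)) * ((d * p).toNNReal : ℝ) ^ n / n.factorial := by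
  have h1 : {n : ℕ | k - 1 ≤ n} = (↑(Finset.range (k - 1)) : Set ℕ)ᶜ := by
    ext n; simp
  rw [phi, po, h1, probReal_compl_eq_one_sub (Finset.measurableSet _),
    ← sum_measureReal_singleton]
  simp only [poissonMeasure_real_singleton]

/-- For `k ≥ 2` the fixed points of `φ_{d,k}` in `[0,1]` do have a greatest element. -/
theorem pStar_isGreatest (d : ℝ) (k : ℕ) (hk : 2 ≤ k) :
    IsGreatest {p | p ∈ Set.Icc (0 : ℝ) 1 ∧ phi d k p = p} (pStar d k) := by
  have hcont : Continuous (phi d k) := by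
    rw [show phi d k = _ from funext (phi_eq d k)]
    fun_prop
  have hcl : IsClosed {p | p ∈ Set.Icc (0 : ℝ) 1 ∧ phi d k p = p} :=
    isClosed_Icc.inter (isClosed_eq hcont continuous_id)
  have hne : {p | p ∈ Set.Icc (0 : ℝ) 1 ∧ phi d k p = p}.Nonempty := by
    refine ⟨0, ⟨le_rfl, zero_le_one⟩, ?_⟩
    obtain ⟨m, hm⟩ : ∃ m, k - 1 = m + 1 := ⟨k - 2, by omega⟩
    rw [phi_eq, hm, Finset.sum_range_succ']
    simp
  have hbd : BddAbove {p | p ∈ Set.Icc (0 : ℝ) 1 ∧ phi d k p = p} := ⟨1, fun p hp => hp.1.2⟩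
  exact ⟨hcl.csSup_mem hne hbd, fun p hp => le_csSup hbd hp⟩

/-! ### The two-type process and its decoration; types `0` and `1` are `false` and `true` -/

/-- The root has type `1` with probability `p` and type `0` with probability `1 - p`. -/
def twoTypeRoot (p : ℝ) : Measure Bool :=
  ENNReal.ofReal p • Measure.dirac true + ENNReal.ofReal (1 - p) • Measure.dirac false

/-- A vertex has `Po(d(1-p))` children of type `0` and, independently, a number of children of type
`1` with distribution `Po_{≥ k-1}(dp)` if the vertex has type `1` and `Po_{< k-1}(dp)` if it has
type `0`. -/
def twoTypeOffspring (d : ℝ) (k : ℕ) (p : ℝ) (z : Bool) : Measure (Bool → ℕ) :=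
  Measure.pi fun
    | false => po (d * (1 - p))
    | true => if z = true then (po (d * p))[|{n | k - 1 ≤ n}] else (po (d * p))[|{n | n < k - 1}]

/-- The law of the two-type process `T*(d,k)`. -/
def twoTypeLaw (d : ℝ) (k : ℕ) : Measure (BranchingSample Bool) :=
  branchingLaw (twoTypeRoot (pStar d k)) (twoTypeOffspring d k (pStar d k))

/-- The upward message of a vertex of `T*(d,k)`, which is its type. -/
def upMsg (ω : BranchingSample Bool) (v : Node Bool) : Bool := ω.type v

/-- The top-down messages on `T*(d,k)`. -/
def downMsg (k : ℕ) (ω : BranchingSample Bool) : Node Bool → Bool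
  | [] => false
  | a :: u => decide (k - 1 ≤ (downMsg k ω u).toNat +
      ∑ w ∈ (ω.children u).erase (a :: u), (upMsg ω w).toNat)

/-- The marks `μ*_v` on `T*(d,k)`. -/
def vertexMark (k : ℕ) (ω : BranchingSample Bool) (v : Node Bool) : Bool :=
  decide (k ≤ (downMsg k ω v).toNat + ∑ w ∈ ω.children v, (upMsg ω w).toNat)

/-- The decorated tree: the tree `T*(d,k)` in which every vertex `v` carries the triple of
its mark, its upward message and its top-down message. -/
def decoratedTree (k : ℕ) (ω : BranchingSample Bool) : RootedMarkedGraph (Bool × Bool × Bool) :=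
  ω.toMarkedGraph fun v => (vertexMark k ω v, upMsg ω v, downMsg k ω v)

/-! ### The five-type process -/

/-- The five types. -/
inductive FiveType
  | t000 | t001 | t010 | t110 | t111
  deriving DecidableEq

namespace FiveType

instance : Fintype FiveType where
  elems := {t000, t001, t010, t110, t111}
  complete := by intro z; cases z <;> decide

instance : MeasurableSpace FiveType := ⊤

/-- The type as a triple of bits. -/
def bits : FiveType → Bool × Bool × Bool
  | t000 => (false, false, false)
  | t001 => (false, false, true)
  | t010 => (false, true, false)
  | t110 => (true, true, false)
  | t111 => (true, true, true)

end FiveType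

/-- `q = P[Po(dp) = k - 1 | Po(dp) ≥ k - 1]`. -/
def qVal (d : ℝ) (k : ℕ) (p : ℝ) : ℝ := ((po (d * p))[|{n | k - 1 ≤ n}]).real {k - 1}

/-- `q̄ = P[Po(dp) = k - 2 | Po(dp) ≤ k - 2]`. -/
def qBar (d : ℝ) (k : ℕ) (p : ℝ) : ℝ := ((po (d * p))[|{n | n ≤ k - 2}]).real {k - 2}

/-- Formal power series in the variables `x_000, …, x_111`. -/
abbrev Series : Type := MvPowerSeries FiveType ℝ

/-- The series `∑_n a_n x_z^n` in the single variable `x_z`. -/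
def oneVar (z : FiveType) (a : ℕ → ℝ) : Series :=
  fun m => if m = Finsupp.single z (m z) then a (m z) else 0

/-- The probability generating function `exp(c (x_z - 1))` of a Poisson number of children of
type `z`. -/
def expSeries (c : ℝ) (z : FiveType) : Series :=
  oneVar z fun n => Real.exp (-c) * c ^ n / n.factorial

/-- `q x_010 + (1 - q) x_110`. -/
def mixSeries (q : ℝ) : Series :=
  MvPowerSeries.C q * MvPowerSeries.X FiveType.t010 +
    MvPowerSeries.C (1 - q) * MvPowerSeries.X FiveType.t110

/-- `(∑_{h < m} c^h (q x_010 + (1 - q) x_110)^h / h!) / (∑_{h < m} c^h / h!)`. -/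
def lowerSeries (c q : ℝ) (m : ℕ) : Series :=
  MvPowerSeries.C (∑ h ∈ Finset.range m, c ^ h / (h.factorial : ℝ))⁻¹ *
    ∑ h ∈ Finset.range m, MvPowerSeries.C (c ^ h / (h.factorial : ℝ)) * mixSeries q ^ h

/-- `(∑_{h ≥ m} (c x_111)^h / h!) / (∑_{h ≥ m} c^h / h!)`. -/
def upperSeries (c : ℝ) (m : ℕ) : Series :=
  MvPowerSeries.C (∑' h : ℕ, if m ≤ h then c ^ h / (h.factorial : ℝ) else 0)⁻¹ *
    oneVar FiveType.t111 fun h => if m ≤ h then c ^ h / h.factorial else 0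

/-- The generating functions of the five offspring distributions. -/
def genFun (d : ℝ) (k : ℕ) (p : ℝ) : FiveType → Series
  | .t000 => expSeries (d * (1 - p)) .t000 * lowerSeries (d * p) (qVal d k p) (k - 1)
  | .t001 =>
      MvPowerSeries.C (qBar d k p) *
        (expSeries (d * (1 - p)) .t001 * mixSeries (qVal d k p) ^ (k - 2)) +
      MvPowerSeries.C (1 - qBar d k p) *
        (expSeries (d * (1 - p)) .t000 * lowerSeries (d * p) (qVal d k p) (k - 2))
  | .t010 => expSeries (d * (1 - p)) .t001 * mixSeries (qVal d k p) ^ (k - 1)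
  | .t110 => expSeries (d * (1 - p)) .t001 * upperSeries (d * p) k
  | .t111 => expSeries (d * (1 - p)) .t001 * upperSeries (d * p) (k - 1)

/-- The coefficient of the monomial `∏_z x_z^{y_z}` in the generating function of type `z`. -/
def offspringProb (d : ℝ) (k : ℕ) (p : ℝ) (z : FiveType) (y : FiveType → ℕ) : ℝ :=
  MvPowerSeries.coeff (Finsupp.equivFunOnFinite.symm y) (genFun d k p z)

/-- The offspring distribution of a vertex of type `z`: the offspring vector is `y` with probability
`offspringProb d k p z y`. -/
def fiveTypeOffspring (d : ℝ) (k : ℕ) (p : ℝ) (z : FiveType) : Measure (FiveType → ℕ) :=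
  Measure.sum fun y => ENNReal.ofReal (offspringProb d k p z y) • Measure.dirac y

/-- The distribution `(p_000, p_010, p_110) = (1 - p, p q, p (1 - q))` of the type of the root. -/
def fiveTypeRoot (d : ℝ) (k : ℕ) (p : ℝ) : Measure FiveType :=
  ENNReal.ofReal (1 - p) • Measure.dirac .t000 +
    ENNReal.ofReal (p * qVal d k p) • Measure.dirac .t010 +
    ENNReal.ofReal (p * (1 - qVal d k p)) • Measure.dirac .t110

/-- The law of the five-type process with parameters `d, k, p`. -/
def fiveTypeLaw (d : ℝ) (k : ℕ) (p : ℝ) : Measure (BranchingSample FiveType) :=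
  branchingLaw (fiveTypeRoot d k p) (fiveTypeOffspring d k p)

/-- The tree of the five-type process, every vertex being marked by its type. -/
def fiveTypeTree (ω : BranchingSample FiveType) : RootedMarkedGraph (Bool × Bool × Bool) :=
  ω.toMarkedGraph fun v => (ω.type v).bits

end

/-! In the two-type tree, let `b` be the top-down message into a vertex of type `z` that has `h`
children of type `1`. The mark is `1` iff `b + h ≥ k`, a child of type `1` receives `1` iff `b + h -
1 ≥ k - 1`, and a child of type `0` receives `1` iff `b + h ≥ k - 1`. So the subtree below a vertex
depends on the rest of the tree only through `b`, and given the offspring vector the subtrees of the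
children are independent.

The law of `h` leaves four cases `(z, b)`. For `(0,0)`, `(0,1)` and `(1,1)` the mark is forced, and
these are the types `000`, `001`, `111`. For `(1,0)` the mark is `0` iff `h = k - 1`, which has
probability `q`, so a vertex with `(1,0)` is a mixture of `010` and `110` with weights `q` and `1 -
q`; this is the source of the series `m = q x_010 + (1 - q) x_110`. For `(0,1)` the children of type
`0` receive `1` iff `h = k - 2`, which has probability `q̄`, whence the two summands of `g_001`.

To make this rigorous, the first `s` generations are encoded by nested multisets (`Code`), which
form a countable set and ignore the order of siblings. `CodeLawsAgree` is proved by induction on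
`s`. The law of a root mark together with a multiset of codes is determined by the integrals of
`g(mark) * ∏ f(code of child)` (`Measure.ext_of_genFunctional`); by the branching property these
integrals satisfy a one-step recursion (`lintegral_codeLaw_succ`), which for the five-type process
is evaluation of the power series `g_z`. The induction step (`codeLawsAgree_succ`) compares the two
recursions case by case.

Finally, equal codes give isomorphic neighbourhoods (`truncate_isomorphic_of_code_eq`), and the
preimage of an open set of classes is an increasing countable union of events on codes
(`identDistrib_of_code`). The assumption `d > d_k` supplies `p* > 0` (`pStar_pos`), so the
conditionings are legitimate. -/

noncomputable section

/-! ### Codes of finite neighbourhoods -/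

/-- The codes of rooted `Y`-marked trees of which only the first `s` generations are kept. -/
def Code (Y : Type) : ℕ → Type
  | 0 => Unit
  | s + 1 => Y × Multiset (Code Y s)

/-- Induction on `S`: a new element `a` is paired with some `b` in `T` of the same image, and
removing both leaves equal multisets of images. -/
theorem Finset.exists_bijOn_of_map_eq {α β γ : Type} [DecidableEq α] [DecidableEq β] [Nonempty β]
    (f : α → γ) (g : β → γ) (S : Finset α) :
    ∀ T : Finset β, S.val.map f = T.val.map g →
      ∃ e : α → β, Set.BijOn e S T ∧ ∀ x ∈ S, g (e x) = f x := by
  induction S using Finset.induction_on with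
  | empty =>
    intro T h
    have hT : T = ∅ := by
      simpa using h.symm
    subst hT
    exact ⟨fun _ => Classical.arbitrary β, by simp, by simp⟩
  | insert a S ha ih =>
    intro T h
    have hmem : f a ∈ T.val.map g := by
      rw [← h]; exact Multiset.mem_map_of_mem f (by simp)
    obtain ⟨b, hb, hba⟩ := Multiset.mem_map.1 hmem
    have hbT : b ∈ T := hb
    have h' : S.val.map f = (T.erase b).val.map g := by
      rw [← Finset.insert_erase hbT, Finset.insert_val_of_notMem ha,
        Finset.insert_val_of_notMem (Finset.notMem_erase b T), Multiset.map_cons,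
        Multiset.map_cons, hba] at h
      exact (Multiset.cons_inj_right _).1 h
    obtain ⟨e, he, hg⟩ := ih _ h'
    have hne : ∀ x ∈ S, x ≠ a := fun x hx hxa => ha (hxa ▸ hx)
    refine ⟨Function.update e a b, ⟨?_, ?_, ?_⟩, ?_⟩
    · intro x hx
      rcases Finset.mem_insert.1 hx with rfl | hx
      · simpa using hbT
      · rw [Function.update_of_ne (hne x hx)]
        exact Finset.mem_of_mem_erase (he.mapsTo hx)
    · intro x hx y hy hxy
      rcases Finset.mem_insert.1 hx with rfl | hx' <;> rcases Finset.mem_insert.1 hy with rfl | hy'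
      · rfl
      · rw [Function.update_self, Function.update_of_ne (hne y hy')] at hxy
        exact absurd (hxy ▸ he.mapsTo hy') (Finset.notMem_erase b T)
      · rw [Function.update_self, Function.update_of_ne (hne x hx')] at hxy
        exact absurd (hxy ▸ he.mapsTo hx') (Finset.notMem_erase b T)
      · rw [Function.update_of_ne (hne x hx'), Function.update_of_ne (hne y hy')] at hxy
        exact he.injOn hx' hy' hxy
    · intro y hy
      by_cases hyb : y = b
      · exact ⟨a, by simp, by simp [hyb]⟩
      · obtain ⟨x, hx, hxy⟩ := he.surjOn (Finset.mem_coe.2 (Finset.mem_erase.2 ⟨hyb, hy⟩))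
        exact ⟨x, by simp [Finset.mem_coe.1 hx], by rw [Function.update_of_ne (hne x hx), hxy]⟩
    · intro x hx
      rcases Finset.mem_insert.1 hx with rfl | hx
      · rw [Function.update_self, hba]
      · rw [Function.update_of_ne (hne x hx), hg x hx]

namespace BranchingSample

/-! ### Distance from the root equals generation -/

section Dist

variable {X : Type} (ω : BranchingSample X)

theorem dist_rootVertex_le : ∀ (u : Node X) (h : ω.IsVertex u),
    ω.graph.dist ω.rootVertex ⟨u, h⟩ ≤ u.length
  | [], _ => by
    have : ω.graph.dist ω.rootVertex ω.rootVertex = 0 := SimpleGraph.dist_self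
    exact this.le
  | a :: u, h => by
    have h1 := dist_rootVertex_le u h.1
    have hadj : ω.graph.Adj ⟨u, h.1⟩ ⟨a :: u, h⟩ := Or.inl ⟨a, rfl⟩
    have h2 := ω.graph_connected.dist_triangle (u := ω.rootVertex) (v := ⟨u, h.1⟩)
      (w := ⟨a :: u, h⟩)
    rw [SimpleGraph.dist_eq_one_iff_adj.2 hadj] at h2
    simp only [List.length_cons]
    omega

/-- Each edge changes the length of the address by exactly one; this gives the lower bound for the
distance from the root. -/
theorem length_le_of_walk {u v : ω.Vertex} (p : ω.graph.Walk u v) :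
    v.1.length ≤ u.1.length + p.length := by
  induction p with
  | nil => simp
  | cons h p ih =>
    rw [SimpleGraph.Walk.length_cons]
    rcases h with ⟨a, h⟩ | ⟨a, h⟩ <;> have := congrArg List.length h <;>
      simp only [List.length_cons] at this <;> omega

theorem dist_rootVertex (v : ω.Vertex) : ω.graph.dist ω.rootVertex v = v.1.length := by
  refine le_antisymm (ω.dist_rootVertex_le v.1 v.2) ?_
  obtain ⟨p, hp⟩ := ω.graph_connected.exists_walk_length_eq_dist ω.rootVertex v
  have := ω.length_le_of_walk p
  rw [hp] at this
  simpa [rootVertex] using this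

end Dist

/-! ### Equal codes give isomorphic neighbourhoods -/

variable {X : Type} [Fintype X] [DecidableEq X] {Y : Type} (ω : BranchingSample X)

/-- The code of the tree of descendants of `u` up to `s` generations. -/
def code (m : Node X → Y) : (s : ℕ) → Node X → Code Y s
  | 0, _ => ()
  | s + 1, u => (m u, (ω.children u).val.map (code m s))

variable {X' : Type} [Fintype X'] [DecidableEq X'] (ω' : BranchingSample X')

open Classical in
/-- A map that matches the children of `u` with children of `u'` of the same code. -/
def matchChildren (m : Node X → Y) (m' : Node X' → Y) (s : ℕ) (u : Node X) (u' : Node X') :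
    Node X → Node X' :=
  if h : ∃ e : Node X → Node X', Set.BijOn e (ω.children u) (ω'.children u') ∧
    ∀ x ∈ ω.children u, ω'.code m' s (e x) = ω.code m s x then h.choose else fun _ => []

theorem matchChildren_spec {m : Node X → Y} {m' : Node X' → Y} {s : ℕ} {u : Node X} {u' : Node X'}
    (h : ω.code m (s + 1) u = ω'.code m' (s + 1) u') :
    Set.BijOn (matchChildren ω ω' m m' s u u') (ω.children u) (ω'.children u') ∧
    ∀ x ∈ ω.children u,
      ω'.code m' s (matchChildren ω ω' m m' s u u' x) = ω.code m s x := by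
  have h2 : (ω.children u).val.map (ω.code m s) = (ω'.children u').val.map (ω'.code m' s) :=
    congrArg Prod.snd h
  have hex := Finset.exists_bijOn_of_map_eq _ _ _ _ h2
  rw [matchChildren, dif_pos hex]
  exact hex.choose_spec

/-- The map that matches the vertices of one tree with those of another, generation by
generation. -/
def matchVertex (m : Node X → Y) (m' : Node X' → Y) (s : ℕ) : Node X → Node X'
  | [] => []
  | a :: u => matchChildren ω ω' m m' (s - u.length) u (matchVertex m m' s u) (a :: u)

theorem exists_eq_cons_of_mem_children {u v : Node X} (h : v ∈ ω.children u) :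
    ∃ a : X × ℕ, v = a :: u ∧ a.2 < ω.offspring u a.1 := by
  simp only [children, Finset.mem_image, Finset.mem_sigma, Finset.mem_univ, true_and,
    Finset.mem_range] at h
  obtain ⟨a, ha, rfl⟩ := h
  exact ⟨(a.1, a.2), rfl, ha⟩

section Match

variable {m : Node X → Y} {m' : Node X' → Y} {s : ℕ}

/-- A code with `s + 1` levels records the marks of generations `0, …, s`. At generation `u.length`
there are still `s - u.length + 1` levels on which `u` and its image agree, and peeling off one
level yields the bijection of children that continues the map. -/
theorem matchVertex_spec (h : ω.code m (s + 1) [] = ω'.code m' (s + 1) []) :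
    ∀ u : Node X, ω.IsVertex u → u.length ≤ s →
      ω'.IsVertex (matchVertex ω ω' m m' s u) ∧ (matchVertex ω ω' m m' s u).length = u.length ∧
      ω.code m (s - u.length + 1) u =
        ω'.code m' (s - u.length + 1) (matchVertex ω ω' m m' s u)
  | [], _, _ => ⟨trivial, rfl, h⟩
  | a :: u, hv, hl => by
    rw [List.length_cons] at hl
    obtain ⟨h1, h2, h3⟩ := matchVertex_spec h u hv.1 (by omega)
    obtain ⟨hb, hc⟩ := matchChildren_spec ω ω' h3
    have hmem : a :: u ∈ ω.children u := (ω.mem_children u a).2 hv.2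
    have hmem' := hb.mapsTo (Finset.mem_coe.2 hmem)
    have hc' := hc _ hmem
    obtain ⟨b, hbe, hbl⟩ := ω'.exists_eq_cons_of_mem_children (Finset.mem_coe.1 hmem')
    have he : matchVertex ω ω' m m' s (a :: u) = b :: matchVertex ω ω' m m' s u := hbe
    refine ⟨?_, ?_, ?_⟩
    · rw [he]; exact ⟨h1, hbl⟩
    · rw [he, List.length_cons, List.length_cons, h2]
    · rw [List.length_cons, show s - (u.length + 1) + 1 = s - u.length by omega]
      exact hc'.symm

theorem matchVertex_cons (h : ω.code m (s + 1) [] = ω'.code m' (s + 1) []) {a : X × ℕ}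
    {u : Node X} (hv : ω.IsVertex (a :: u)) (hl : u.length ≤ s) :
    ∃ b, matchVertex ω ω' m m' s (a :: u) = b :: matchVertex ω ω' m m' s u := by
  obtain ⟨h1, h2, h3⟩ := matchVertex_spec ω ω' h u hv.1 hl
  obtain ⟨hb, hc⟩ := matchChildren_spec ω ω' h3
  have hmem' := hb.mapsTo (Finset.mem_coe.2 ((ω.mem_children u a).2 hv.2))
  obtain ⟨b, hbe, hbl⟩ := ω'.exists_eq_cons_of_mem_children (Finset.mem_coe.1 hmem')
  exact ⟨b, hbe⟩

/-- The tail of an image is the image of the parent. Equal images thus have equal parents by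
induction, and the map is injective on the children of one parent. -/
theorem matchVertex_injective (h : ω.code m (s + 1) [] = ω'.code m' (s + 1) []) :
    ∀ u v : Node X, ω.IsVertex u → ω.IsVertex v → u.length ≤ s → v.length ≤ s →
      matchVertex ω ω' m m' s u = matchVertex ω ω' m m' s v → u = v
  | [], [], _, _, _, _, _ => rfl
  | [], b :: v, hu, hv, hul, hvl, e => by
    have h1 := (matchVertex_spec ω ω' h [] hu hul).2.1
    have h2 := (matchVertex_spec ω ω' h _ hv hvl).2.1
    rw [e, h2] at h1
    simp at h1
  | a :: u, [], hu, hv, hul, hvl, e => by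
    have h1 := (matchVertex_spec ω ω' h _ hu hul).2.1
    have h2 := (matchVertex_spec ω ω' h [] hv hvl).2.1
    rw [e, h2] at h1
    simp at h1
  | a :: u, b :: v, hu, hv, hul, hvl, e => by
    rw [List.length_cons] at hul hvl
    obtain ⟨c, hc⟩ := matchVertex_cons ω ω' h hu (by omega)
    obtain ⟨c', hc'⟩ := matchVertex_cons ω ω' h hv (by omega)
    have e' : matchVertex ω ω' m m' s u = matchVertex ω ω' m m' s v := by
      rw [hc, hc'] at e
      exact (List.cons.inj e).2
    have huv := matchVertex_injective h u v hu.1 hv.1 (by omega) (by omega) e'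
    subst huv
    obtain ⟨hb, -⟩ := matchChildren_spec ω ω' (matchVertex_spec ω ω' h u hu.1 (by omega)).2.2
    exact hb.injOn (Finset.mem_coe.2 ((ω.mem_children u a).2 hu.2))
      (Finset.mem_coe.2 ((ω.mem_children u b).2 hv.2)) e

theorem matchVertex_surjective (h : ω.code m (s + 1) [] = ω'.code m' (s + 1) []) :
    ∀ v : Node X', ω'.IsVertex v → v.length ≤ s →
      ∃ u, ω.IsVertex u ∧ u.length ≤ s ∧ matchVertex ω ω' m m' s u = v
  | [], _, _ => ⟨[], trivial, by simp, rfl⟩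
  | b :: v, hv, hl => by
    rw [List.length_cons] at hl
    obtain ⟨u, hu, hul, rfl⟩ := matchVertex_surjective h v hv.1 (by omega)
    obtain ⟨-, h2, h3⟩ := matchVertex_spec ω ω' h u hu hul
    obtain ⟨hb, -⟩ := matchChildren_spec ω ω' h3
    obtain ⟨w, hw, hwe⟩ := hb.surjOn (Finset.mem_coe.2 ((ω'.mem_children _ b).2 hv.2))
    obtain ⟨a, rfl, hal⟩ := ω.exists_eq_cons_of_mem_children (Finset.mem_coe.1 hw)
    exact ⟨a :: u, ⟨hu, hal⟩, by rw [List.length_cons]; omega, hwe⟩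

/-- Used to reflect adjacency: the image of the parent of `v` is the image of `u`, so injectivity
identifies the two. -/
theorem exists_eq_cons_of_matchVertex (h : ω.code m (s + 1) [] = ω'.code m' (s + 1) [])
    {u v : Node X} (hu : ω.IsVertex u) (hv : ω.IsVertex v) (hul : u.length ≤ s)
    (hvl : v.length ≤ s) {b : X' × ℕ}
    (e : matchVertex ω ω' m m' s v = b :: matchVertex ω ω' m m' s u) : ∃ a, v = a :: u := by
  cases v with
  | nil => simp [matchVertex] at e
  | cons a v =>
    rw [List.length_cons] at hvl
    obtain ⟨c, hc⟩ := matchVertex_cons ω ω' h hv (by omega)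
    rw [hc] at e
    exact ⟨a, congrArg _ (matchVertex_injective ω ω' h v u hv.1 hu (by omega) hul
      (List.cons.inj e).2)⟩

/-- Trees whose codes agree up to generation `s` have isomorphic neighbourhoods of radius `s`. -/
theorem truncate_isomorphic_of_code_eq (h : ω.code m (s + 1) [] = ω'.code m' (s + 1) []) :
    RootedMarkedGraph.truncate s (ω.toMarkedGraph m) ≈
      RootedMarkedGraph.truncate s (ω'.toMarkedGraph m') := by
  have hlen : ∀ v : (RootedMarkedGraph.truncate s (ω.toMarkedGraph m)).V, v.1.1.length ≤ s :=
    fun v => (ω.dist_rootVertex v.1).symm.le.trans v.2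
  have hlen' : ∀ v : (RootedMarkedGraph.truncate s (ω'.toMarkedGraph m')).V,
      v.1.1.length ≤ s := fun v => (ω'.dist_rootVertex v.1).symm.le.trans v.2
  have key : ∀ v : (RootedMarkedGraph.truncate s (ω.toMarkedGraph m)).V, _ := fun v =>
    matchVertex_spec ω ω' h v.1.1 v.1.2 (hlen v)
  let f : (RootedMarkedGraph.truncate s (ω.toMarkedGraph m)).V →
      (RootedMarkedGraph.truncate s (ω'.toMarkedGraph m')).V := fun v =>
    ⟨⟨matchVertex ω ω' m m' s v.1.1, (key v).1⟩, by
      refine (ω'.dist_rootVertex _).le.trans ?_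
      exact (key v).2.1.le.trans (hlen v)⟩
  have hinj : Function.Injective f := fun u v huv => by
    refine Subtype.ext (Subtype.ext (matchVertex_injective ω ω' h _ _ u.1.2 v.1.2 (hlen u) (hlen v)
      ?_))
    exact congrArg (fun x => x.1.1) huv
  have hsurj : Function.Surjective f := fun v => by
    obtain ⟨u, hu, hul, huv⟩ := matchVertex_surjective ω ω' h v.1.1 v.1.2 (hlen' v)
    exact ⟨⟨⟨u, hu⟩, (ω.dist_rootVertex ⟨u, hu⟩).le.trans hul⟩, Subtype.ext (Subtype.ext huv)⟩
  refine ⟨⟨Equiv.ofBijective f ⟨hinj, hsurj⟩, ?_⟩, rfl, ?_⟩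
  · intro u v
    change ((∃ a, matchVertex ω ω' m m' s v.1.1 = a :: matchVertex ω ω' m m' s u.1.1) ∨
      ∃ a, matchVertex ω ω' m m' s u.1.1 = a :: matchVertex ω ω' m m' s v.1.1) ↔
      ((∃ a, v.1.1 = a :: u.1.1) ∨ ∃ a, u.1.1 = a :: v.1.1)
    constructor
    · rintro (⟨a, ha⟩ | ⟨a, ha⟩)
      · exact Or.inl (exists_eq_cons_of_matchVertex ω ω' h u.1.2 v.1.2 (hlen u) (hlen v) ha)
      · exact Or.inr (exists_eq_cons_of_matchVertex ω ω' h v.1.2 u.1.2 (hlen v) (hlen u) ha)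
    · rintro (⟨a, ha⟩ | ⟨a, ha⟩)
      · left
        have hv := v.1.2
        rw [ha] at hv ⊢
        exact matchVertex_cons ω ω' h hv (hlen u)
      · right
        have hu := u.1.2
        rw [ha] at hu ⊢
        exact matchVertex_cons ω ω' h hu (hlen v)
  · intro v
    exact congrArg Prod.fst (key v).2.2

end Match

end BranchingSample

end

noncomputable section

/-! ### Branching processes with a decoration that is computed top-down -/

instance Code.instMeasurableSpace (Y : Type) (s : ℕ) : MeasurableSpace (Code Y s) := ⊤

instance Code.instDiscreteMeasurableSpace (Y : Type) (s : ℕ) :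
    DiscreteMeasurableSpace (Code Y s) := ⟨fun _ => trivial⟩

theorem Code.countable (Y : Type) [Countable Y] : ∀ s, Countable (Code Y s)
  | 0 => inferInstanceAs (Countable Unit)
  | s + 1 => by
    have := Code.countable Y s
    exact inferInstanceAs (Countable (Y × Multiset (Code Y s)))

instance Code.instCountable (Y : Type) [Countable Y] (s : ℕ) : Countable (Code Y s) :=
  Code.countable Y s

/-- A rule that computes a state in `S` and a mark in `Y` for every vertex of a branching process.
The state of a child is determined by the state, the type and the offspring of its parent. -/
structure Decoration (X S Y : Type) where
  /-- the state of a child -/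
  step : S → X → (X → ℕ) → X × ℕ → S
  /-- the mark of a vertex -/
  mark : S → X → (X → ℕ) → Y

/-- The children of a vertex with given offspring vector. -/
def kids {X : Type} [Fintype X] (y : X → ℕ) : Finset (X × ℕ) :=
  (Finset.univ.sigma fun z : X => Finset.range (y z)).map (Equiv.sigmaEquivProd X ℕ).toEmbedding

theorem prod_kids {X M : Type} [Fintype X] [CommMonoid M] (y : X → ℕ) (f : X × ℕ → M) :
    ∏ a ∈ kids y, f a = ∏ x, ∏ i ∈ Finset.range (y x), f (x, i) := by
  simp [kids, Finset.prod_sigma]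

/-- The choices in the tree of descendants of the child `a` of the root. -/
def shift {X : Type} (η : Node X × X → X → ℕ) (a : X × ℕ) : Node X × X → X → ℕ :=
  fun j => η (j.1 ++ [a], j.2)

theorem measurable_shift {X : Type} (a : X × ℕ) :
    Measurable fun η : Node X × X → X → ℕ => shift η a :=
  measurable_pi_lambda _ fun j => measurable_pi_apply (j.1 ++ [a], j.2)

namespace BranchingSample

theorem type_append {X : Type} (z : X) (η : Node X × X → X → ℕ) (a : X × ℕ) (u : Node X) :
    type (z, η) (u ++ [a]) = type (a.1, shift η a) u := by
  cases u <;> rfl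

theorem offspring_append {X : Type} (z : X) (η : Node X × X → X → ℕ) (a : X × ℕ) (u : Node X) :
    offspring (z, η) (u ++ [a]) = offspring (a.1, shift η a) u := by
  rw [offspring, offspring, type_append]
  rfl

variable {X : Type} [Fintype X] [DecidableEq X]

theorem children_eq (ω : BranchingSample X) (u : Node X) :
    ω.children u =
      (kids (ω.offspring u)).map ⟨fun a => a :: u, fun _ _ h => (List.cons.inj h).1⟩ := by
  ext v
  simp only [children, kids, Finset.mem_image, Finset.mem_map, Function.Embedding.coeFn_mk]
  constructor
  · rintro ⟨a, ha, rfl⟩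
    exact ⟨(a.1, a.2), ⟨a, ha, rfl⟩, rfl⟩
  · rintro ⟨a, ⟨b, hb, rfl⟩, rfl⟩
    exact ⟨b, hb, rfl⟩

theorem code_succ {Y : Type} (ω : BranchingSample X) (m : Node X → Y) (s : ℕ) (u : Node X) :
    ω.code m (s + 1) u =
      (m u, (kids (ω.offspring u)).val.map fun a => ω.code m s (a :: u)) := by
  rw [code, children_eq, Finset.map_val, Multiset.map_map]
  rfl

end BranchingSample

namespace Decoration

open BranchingSample

section State

variable {X S Y : Type} (D : Decoration X S Y) (ω : BranchingSample X) (b : S)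

/-- The state of a vertex if the state of the root is `b`. -/
def state : Node X → S
  | [] => b
  | a :: u => D.step (state u) (ω.type u) (ω.offspring u) a

/-- The mark of a vertex if the state of the root is `b`. -/
def label (u : Node X) : Y := D.mark (D.state ω b u) (ω.type u) (ω.offspring u)

/-- Addresses list the steps from the vertex back to the root, so `u ++ [a]` is the vertex `u` of
the subtree at the root's child `a`. All influence from above enters that subtree through the state
of `a`. -/
theorem state_append (z : X) (η : Node X × X → X → ℕ) (a : X × ℕ) :
    ∀ u : Node X, D.state (z, η) b (u ++ [a]) =
      D.state (a.1, shift η a) (D.step b z (η ([], z)) a) u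
  | [] => rfl
  | c :: u => by
    rw [List.cons_append, state, state, state_append z η a u, type_append, offspring_append]

theorem label_append (z : X) (η : Node X × X → X → ℕ) (a : X × ℕ) (u : Node X) :
    D.label (z, η) b (u ++ [a]) =
      D.label (a.1, shift η a) (D.step b z (η ([], z)) a) u := by
  rw [label, label, state_append, type_append, offspring_append]

end State

variable {X S Y : Type} [Fintype X] [DecidableEq X] (D : Decoration X S Y) (b : S)

theorem code_append (z : X) (η : Node X × X → X → ℕ) (a : X × ℕ) :
    ∀ (s : ℕ) (u : Node X), code (z, η) (D.label (z, η) b) s (u ++ [a]) =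
      code (a.1, shift η a) (D.label (a.1, shift η a) (D.step b z (η ([], z)) a)) s u
  | 0, _ => rfl
  | s + 1, u => by
    rw [code_succ, code_succ, label_append, offspring_append]
    congr 1
    refine Multiset.map_congr rfl fun c _ => ?_
    exact code_append z η a s (c :: u)

/-- The code of the first `s` generations of the process with root type `z` and root state `b`. -/
def rootCode (s : ℕ) (z : X) (η : Node X × X → X → ℕ) : Code Y s :=
  code (z, η) (D.label (z, η) b) s []

/-- The root's offspring vector fixes the mark and the states of the children; everything else
depends on the shifted choices of the individual children. -/
theorem rootCode_succ (s : ℕ) (z : X) (η : Node X × X → X → ℕ) :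
    D.rootCode b (s + 1) z η = (D.mark b z (η ([], z)), (kids (η ([], z))).val.map fun a =>
      D.rootCode (D.step b z (η ([], z)) a) s a.1 (shift η a)) := by
  rw [rootCode, code_succ]
  congr 1
  refine Multiset.map_congr rfl fun c _ => ?_
  exact D.code_append b z η c s []

variable [Countable Y]

theorem measurable_rootCode (s : ℕ) : ∀ (b : S) (z : X), Measurable (D.rootCode b s z) := by
  induction s with
  | zero => exact fun b z => measurable_const
  | succ s ih =>
    intro b z
    let F : (X → ℕ) × (Node X × X → X → ℕ) → Code Y (s + 1) := fun w =>
      (D.mark b z w.1, (kids w.1).val.map fun a =>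
        D.rootCode (D.step b z w.1 a) s a.1 (shift w.2 a))
    have hF : Measurable F := by
      -- There are countably many offspring vectors. For fixed `y` the children and their states are
      -- fixed, and the code is a function of finitely many discrete variables.
      refine measurable_from_prod_countable_right fun y => ?_
      let H : ((kids y) → Code Y s) → Code Y (s + 1) := fun c =>
        (D.mark b z y, Finset.univ.val.map c)
      have hH : Measurable H := Measurable.of_discrete
      have hc : Measurable fun (η : Node X × X → X → ℕ) (a : kids y) =>
          D.rootCode (D.step b z y a.1) s a.1.1 (shift η a.1) :=
        measurable_pi_lambda _ fun a => (ih _ _).comp (measurable_shift a.1)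
      convert hH.comp hc using 1
      funext η
      refine Prod.ext rfl ?_
      simp only [F, H, Function.comp]
      rw [Finset.univ_eq_attach, Finset.attach_val]
      exact (Multiset.attach_map_val' (kids y).val _).symm
    have : D.rootCode b (s + 1) z = fun η => F (η ([], z), η) := by
      funext η
      exact D.rootCode_succ b s z η
    rw [this]
    exact hF.comp ((measurable_pi_apply _).prodMk measurable_id)

end Decoration

/-! ### Independence of the subtrees of the children of the root -/

section Independence

variable {X : Type}

/-- The choices are grouped into those at the root and those below each child of the root. -/
def GroupIndex (X : Type) : Option (X × ℕ) → Type
  | none => X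
  | some _ => Node X × X

/-- The position of a choice in its group. -/
def groupPosition : (o : Option (X × ℕ)) → GroupIndex X o → Node X × X
  | none, x => ([], x)
  | some a, j => (j.1 ++ [a], j.2)

theorem groupPosition_injective :
    Function.Injective fun i : (o : Option (X × ℕ)) × GroupIndex X o => groupPosition i.1 i.2 := by
  rintro ⟨_ | a, j⟩ ⟨_ | a', j'⟩ h
  · have h2 : j = j' := congrArg Prod.snd h
    rw [h2]
  · have h1 : ([] : Node X) = j'.1 ++ [a'] := congrArg Prod.fst h
    simp at h1
  · have h1 : j.1 ++ [a] = ([] : Node X) := congrArg Prod.fst h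
    simp at h1
  · have h1 : j.1 ++ [a] = j'.1 ++ [a'] := congrArg Prod.fst h
    have h2 : (j : Node X × X).2 = (j' : Node X × X).2 := (Prod.ext_iff.1 h).2
    obtain ⟨h3, h4⟩ := List.append_inj' h1 rfl
    have h5 : a = a' := by simpa using h4
    subst h5
    exact congrArg (Sigma.mk (some a)) (Prod.ext h3 h2)

/-- The choices of a branching process, without the type of the root. -/
abbrev choiceLaw (off : X → Measure (X → ℕ)) : Measure (Node X × X → X → ℕ) :=
  Measure.infinitePi fun i : Node X × X => off i.2

variable (off : X → Measure (X → ℕ)) [∀ z, IsProbabilityMeasure (off z)]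

theorem map_group (o : Option (X × ℕ)) :
    (choiceLaw off).map (fun η (j : GroupIndex X o) => η (groupPosition o j)) =
      Measure.infinitePi fun j => off (groupPosition o j).2 :=
  Measure.map_infinitePi_infinitePi_of_inj (P := fun i : Node X × X => off i.2)
    (f := groupPosition o) fun j j' h => by
      have := @groupPosition_injective X ⟨o, j⟩ ⟨o, j'⟩ h
      simpa using this

theorem map_shift (a : X × ℕ) :
    (choiceLaw off).map (fun η => shift η a) = choiceLaw off :=
  map_group off (some a)

/-- The groups occupy disjoint sets of coordinates of a product measure: injectivity of the
positions makes the joint law an infinite product, and currying it over the groups displays it as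
the product of the group laws. -/
theorem iIndepFun_groups :
    iIndepFun (fun (o : Option (X × ℕ)) (η : Node X × X → X → ℕ) (j : GroupIndex X o) =>
      η (groupPosition o j)) (choiceLaw off) := by
  rw [iIndepFun_iff_map_fun_eq_infinitePi_map
    fun o => measurable_pi_lambda _ fun j => measurable_pi_apply _]
  simp_rw [map_group off]
  have h1 := Measure.map_infinitePi_infinitePi_of_inj (P := fun i : Node X × X => off i.2)
    (groupPosition_injective (X := X))
  have h2 := Measure.infinitePi_map_piCurry
    (μ := fun (o : Option (X × ℕ)) (j : GroupIndex X o) => off (groupPosition o j).2)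
  have h3 := Measure.map_map (μ := choiceLaw off)
    (MeasurableEquiv.measurable (MeasurableEquiv.piCurry
      fun (o : Option (X × ℕ)) (_ : GroupIndex X o) => X → ℕ))
    (measurable_pi_lambda (fun (η : Node X × X → X → ℕ)
      (i : (o : Option (X × ℕ)) × GroupIndex X o) => η (groupPosition i.1 i.2))
      fun j => measurable_pi_apply _)
  rw [← h2, ← h1]
  exact h3.symm

end Independence

/-! ### The branching property for generating functionals of codes -/

namespace Decoration

variable {X S Y : Type} [Fintype X] [DecidableEq X] [Countable Y] (D : Decoration X S Y)
  (off : X → Measure (X → ℕ)) [∀ z, IsProbabilityMeasure (off z)]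

/-- The law of the code of the first `s` generations. -/
def codeLaw (b : S) (s : ℕ) (z : X) : Measure (Code Y s) :=
  (choiceLaw off).map (D.rootCode b s z)

instance (b : S) (s : ℕ) (z : X) : IsProbabilityMeasure (D.codeLaw off b s z) :=
  Measure.isProbabilityMeasure_map (D.measurable_rootCode s b z).aemeasurable

/-- With the states `b a` held constant, the factors depend on different groups of choices, so the
integral factorises; `map_shift` gives each subtree the law of the whole. -/
theorem lintegral_indicator_mul_prod (b : X × ℕ → S) (s : ℕ) (z : X) (y : X → ℕ)
    (A : Finset (X × ℕ)) (f : Code Y s → ENNReal) :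
    ∫⁻ η, ({y' | y' = y} : Set (X → ℕ)).indicator 1 (η ([], z)) *
        ∏ a ∈ A, f (D.rootCode (b a) s a.1 (shift η a)) ∂choiceLaw off =
      off z {y} * ∏ a ∈ A, ∫⁻ c, f c ∂D.codeLaw off (b a) s a.1 := by
  let φ : (o : Option (X × ℕ)) → (GroupIndex X o → X → ℕ) → ENNReal := fun o =>
    match o with
    | none => fun ζ => ({y' | y' = y} : Set (X → ℕ)).indicator 1 (ζ z)
    | some a => fun ζ => f (D.rootCode (b a) s a.1 ζ)
  have hφ : ∀ o, Measurable (φ o) := by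
    rintro (_ | a)
    · exact (measurable_one.indicator MeasurableSet.of_discrete).comp
        (measurable_pi_apply (show GroupIndex X none from z))
    · exact (Measurable.of_discrete (f := f)).comp (D.measurable_rootCode s (b a) a.1)
  have hm : ∀ o : Option (X × ℕ), Measurable fun (η : Node X × X → X → ℕ) (j : GroupIndex X o) =>
      η (groupPosition o j) := fun o => measurable_pi_lambda _ fun j => measurable_pi_apply _
  have h := lintegral_prod_eq_prod_lintegral_of_indepFun (Finset.insertNone A) _
    ((iIndepFun_groups off).comp φ hφ) fun o => (hφ o).comp (hm o)
  simp only [Finset.prod_insertNone] at h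
  refine Eq.trans h ?_
  congr 1
  · change ∫⁻ η, ({y' | y' = y} : Set (X → ℕ)).indicator 1 (η ([], z)) ∂choiceLaw off = _
    have h1 := lintegral_map (μ := choiceLaw off)
      (f := ({y' | y' = y} : Set (X → ℕ)).indicator (1 : (X → ℕ) → ENNReal))
      (measurable_one.indicator MeasurableSet.of_discrete)
      (measurable_pi_apply (([], z) : Node X × X))
    rw [← h1, Measure.infinitePi_map_eval, lintegral_indicator_one MeasurableSet.of_discrete]
    rfl
  · refine Finset.prod_congr rfl fun a _ => ?_
    change ∫⁻ η, f (D.rootCode (b a) s a.1 (shift η a)) ∂choiceLaw off = _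
    rw [codeLaw, lintegral_map Measurable.of_discrete (D.measurable_rootCode s (b a) a.1)]
    have h1 := lintegral_map (μ := choiceLaw off) (f := fun ζ => f (D.rootCode (b a) s a.1 ζ))
      ((Measurable.of_discrete (f := f)).comp (D.measurable_rootCode s (b a) a.1))
      (measurable_shift a)
    rw [map_shift] at h1
    exact h1.symm

/-- The recursion for the generating functionals of the codes. -/
theorem lintegral_codeLaw_succ (b : S) (s : ℕ) (z : X) (g : Y → ENNReal)
    (f : Code Y s → ENNReal) :
    ∫⁻ c : Y × Multiset (Code Y s), g c.1 * (c.2.map f).prod ∂D.codeLaw off b (s + 1) z =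
      ∑' y : X → ℕ, off z {y} * (g (D.mark b z y) * ∏ x, ∏ i ∈ Finset.range (y x),
        ∫⁻ c, f c ∂D.codeLaw off (D.step b z y (x, i)) s x) := by
  let F : Code Y (s + 1) → ENNReal := fun c => g c.1 * (c.2.map f).prod
  have h0 : ∫⁻ c, F c ∂D.codeLaw off b (s + 1) z =
      ∫⁻ η, F (D.rootCode b (s + 1) z η) ∂choiceLaw off :=
    lintegral_map Measurable.of_discrete (D.measurable_rootCode (s + 1) b z)
  refine Eq.trans h0 ?_
  -- Partition by the root's offspring vector: only the term at its actual value survives, and in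
  -- each term the states of the children have become constants.
  have h1 : ∀ η, F (D.rootCode b (s + 1) z η) = ∑' y : X → ℕ, g (D.mark b z y) *
      (({y' | y' = y} : Set (X → ℕ)).indicator 1 (η ([], z)) *
        ∏ a ∈ kids y, f (D.rootCode (D.step b z y a) s a.1 (shift η a))) := by
    intro η
    rw [tsum_eq_single (η ([], z)), rootCode_succ]
    · simp only [F, Multiset.map_map, Set.indicator_of_mem (show _ ∈ {y' | y' = η ([], z)} from rfl),
        Pi.one_apply, one_mul]
      rfl
    · intro y hy
      have : η ([], z) ∉ ({y' | y' = y} : Set (X → ℕ)) := fun h => hy h.symm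
      rw [Set.indicator_of_notMem this]
      simp
  simp_rw [h1]
  have hmeas : ∀ y : X → ℕ, Measurable fun η : Node X × X → X → ℕ =>
      (({y' | y' = y} : Set (X → ℕ)).indicator (1 : (X → ℕ) → ENNReal) (η ([], z)) *
        ∏ a ∈ kids y, f (D.rootCode (D.step b z y a) s a.1 (shift η a))) := by
    intro y
    refine Measurable.mul ((measurable_one.indicator MeasurableSet.of_discrete).comp
      (measurable_pi_apply _)) (Finset.measurable_prod _ fun a _ => ?_)
    exact ((Measurable.of_discrete (f := f)).comp (D.measurable_rootCode s _ a.1)).comp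
      (measurable_shift a)
  rw [lintegral_tsum fun y => ((hmeas y).const_mul _).aemeasurable]
  congr 1
  funext y
  rw [lintegral_const_mul _ (hmeas y), lintegral_indicator_mul_prod D off (D.step b z y) s z y,
    prod_kids]
  ring

end Decoration
end

noncomputable section

/-! ### Generating functionals determine laws of random multisets -/

section Uniqueness

open scoped NNReal BoundedContinuousFunction

variable {Y C : Type}

/-- The functional `(y, M) ↦ g y * ∏_{c ∈ M} f c`. -/
def genFunctional (g : Y → ℝ≥0) (f : C → ℝ≥0) (e : Y × Multiset C) : ℝ≥0 :=
  g e.1 * (e.2.map f).prod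

theorem Multiset.prod_map_le_one {f : C → ℝ≥0} (hf : ∀ c, f c ≤ 1) (M : Multiset C) :
    (M.map f).prod ≤ 1 := by
  induction M using Multiset.induction_on with
  | empty => simp
  | cons c M ih => simpa using mul_le_one' (hf c) ih

theorem genFunctional_le_one {g : Y → ℝ≥0} {f : C → ℝ≥0} (hg : ∀ y, g y ≤ 1) (hf : ∀ c, f c ≤ 1)
    (e : Y × Multiset C) : genFunctional g f e ≤ 1 :=
  mul_le_one' (hg _) (Multiset.prod_map_le_one hf _)

/-- Different first components are separated by an indicator. Otherwise some `c` has different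
multiplicities, and weight `1/2` at `c` and `1` elsewhere turns multiplicity `n` into `2⁻ⁿ`. -/
theorem exists_genFunctional_ne {e e' : Y × Multiset C} (h : e ≠ e') :
    ∃ (g : Y → ℝ≥0) (f : C → ℝ≥0), (∀ y, g y ≤ 1) ∧ (∀ c, f c ≤ 1) ∧
      genFunctional g f e ≠ genFunctional g f e' := by
  classical
  by_cases h1 : e.1 = e'.1
  · have h2 : e.2 ≠ e'.2 := fun h2 => h (Prod.ext h1 h2)
    obtain ⟨c, hc⟩ : ∃ c, e.2.count c ≠ e'.2.count c := by
      by_contra! hcon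
      exact h2 (Multiset.ext.2 hcon)
    refine ⟨fun _ => 1, fun x => if x = c then 2⁻¹ else 1, fun _ => le_rfl, fun x => ?_, ?_⟩
    · dsimp only
      split_ifs
      · exact inv_le_one_of_one_le₀ one_le_two
      · exact le_rfl
    · have key : ∀ M : Multiset C,
          (M.map fun x => if x = c then (2⁻¹ : ℝ≥0) else 1).prod = 2⁻¹ ^ M.count c := by
        intro M
        induction M using Multiset.induction_on with
        | empty => simp
        | cons x M ih =>
          rw [Multiset.map_cons, Multiset.prod_cons, ih, Multiset.count_cons]
          by_cases hx : x = c
          · simp [hx, pow_succ, mul_comm]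
          · simp [hx, Ne.symm hx]
      simp only [genFunctional, key, one_mul]
      intro hcon
      refine hc (pow_right_injective₀ (a := (2⁻¹ : ℝ≥0)) (by positivity) ?_ hcon)
      intro h3
      simp at h3
  · refine ⟨fun y => if y = e.1 then 1 else 0, fun _ => 1, fun y => ?_, fun _ => le_rfl, ?_⟩
    · dsimp only
      split_ifs <;> simp
    · simp [genFunctional, Ne.symm h1]

/-- The functionals with `g, f ≤ 1` contain `1` and are closed under products, so their span is an
algebra of bounded functions, continuous for the discrete topology. It separates points, and hence
determines finite measures on this countable discrete, thus Polish, space. -/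
theorem Measure.ext_of_genFunctional [Countable Y] [Countable C] [MeasurableSpace (Y × Multiset C)]
    [DiscreteMeasurableSpace (Y × Multiset C)] {μ ν : Measure (Y × Multiset C)} [IsFiniteMeasure μ]
    [IsFiniteMeasure ν]
    (h : ∀ (g : Y → ℝ≥0) (f : C → ℝ≥0), (∀ y, g y ≤ 1) → (∀ c, f c ≤ 1) →
      ∫⁻ e, genFunctional g f e ∂μ = ∫⁻ e, genFunctional g f e ∂ν) : μ = ν := by
  let _ : TopologicalSpace (Y × Multiset C) := ⊥
  have : DiscreteTopology (Y × Multiset C) := ⟨rfl⟩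
  have : BorelSpace (Y × Multiset C) := inferInstance
  let T : Submonoid ((Y × Multiset C) →ᵇ ℝ) :=
    { carrier := {φ | ∃ (g : Y → ℝ≥0) (f : C → ℝ≥0), (∀ y, g y ≤ 1) ∧ (∀ c, f c ≤ 1) ∧
        ∀ e, φ e = genFunctional g f e}
      one_mem' := ⟨fun _ => 1, fun _ => 1, fun _ => le_rfl, fun _ => le_rfl, by
        simp [genFunctional]⟩
      mul_mem' := by
        rintro φ ψ ⟨g, f, hg, hf, hφ⟩ ⟨g', f', hg', hf', hψ⟩
        refine ⟨g * g', f * f', fun y => mul_le_one' (hg y) (hg' y),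
          fun c => mul_le_one' (hf c) (hf' c), fun e => ?_⟩
        rw [BoundedContinuousFunction.mul_apply, hφ, hψ, ← NNReal.coe_mul]
        congr 1
        simp only [genFunctional, Pi.mul_apply]
        rw [Multiset.prod_map_mul]
        ring }
  refine ext_of_forall_mem_subalgebra_integral_eq_of_polish (𝕜 := ℝ)
    (A := StarAlgebra.adjoin ℝ (T : Set ((Y × Multiset C) →ᵇ ℝ))) ?_ ?_
  · intro e e' hne
    obtain ⟨g, f, hg, hf, hgf⟩ := exists_genFunctional_ne hne
    let φ : (Y × Multiset C) →ᵇ ℝ := BoundedContinuousFunction.ofNormedAddCommGroup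
      (fun e => (genFunctional g f e : ℝ)) continuous_of_discreteTopology 1 fun e => by
        simpa using genFunctional_le_one hg hf e
    refine ⟨φ, ⟨(BoundedContinuousFunction.toContinuousMapStarₐ ℝ) φ, ⟨φ,
      StarAlgebra.subset_adjoin ℝ _ ⟨g, f, hg, hf, fun e => rfl⟩, rfl⟩, rfl⟩, ?_⟩
    intro hcon
    exact hgf (NNReal.coe_injective hcon)
  · intro φ hφ
    -- On real functions the star is trivial, so the star algebra is the algebra generated by `T`;
    -- as `T` is a monoid, this is its linear span, and linearity of the integral reduces the claim
    -- to `T` itself.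
    have hφ' : φ ∈ Submodule.span ℝ (T : Set ((Y × Multiset C) →ᵇ ℝ)) := by
      have hstar : star (T : Set ((Y × Multiset C) →ᵇ ℝ)) = T := by
        ext ψ
        rw [Set.mem_star]
        have : star ψ = ψ := by ext; simp
        rw [this]
      have h1 : φ ∈ Algebra.adjoin ℝ ((T : Set ((Y × Multiset C) →ᵇ ℝ)) ∪ star T) := hφ
      rw [hstar, Set.union_self] at h1
      have h2 := Algebra.adjoin_eq_span ℝ (T : Set ((Y × Multiset C) →ᵇ ℝ))
      rw [Submonoid.closure_eq] at h2
      rw [← h2]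
      exact h1
    clear hφ
    induction hφ' using Submodule.span_induction with
    | mem φ hφ =>
      obtain ⟨g, f, hg, hf, hφ⟩ := hφ
      simp_rw [hφ]
      have key : ∀ ρ : Measure (Y × Multiset C), ∫ e, (genFunctional g f e : ℝ) ∂ρ =
          (∫⁻ e, genFunctional g f e ∂ρ).toReal := fun ρ => by
        rw [integral_eq_lintegral_of_nonneg_ae (Filter.Eventually.of_forall fun e => by positivity)
          (Measurable.of_discrete.aestronglyMeasurable)]
        simp
      rw [key, key, h g f hg hf]
    | zero => simp
    | add φ ψ _ _ h1 h2 =>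
      simp only [BoundedContinuousFunction.add_apply]
      rw [integral_add (φ.integrable μ) (ψ.integrable μ),
        integral_add (φ.integrable ν) (ψ.integrable ν)]
      rw [h1, h2]
    | smul r φ _ h1 =>
      simp only [BoundedContinuousFunction.coe_smul]
      rw [integral_smul, integral_smul, h1]

end Uniqueness
end

noncomputable section

/-! ### Evaluation of power series with nonnegative coefficients -/

namespace Series

open scoped ENNReal

/-- All coefficients are nonnegative. -/
def NonnegCoeff (g : Series) : Prop := ∀ m, 0 ≤ MvPowerSeries.coeff m g

/-- The value of the monomial with exponents `m` at `w`. -/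
def monomialValue (w : FiveType → ℝ≥0∞) (m : FiveType →₀ ℕ) : ℝ≥0∞ := ∏ t, w t ^ m t

/-- The value at `w` of a power series with nonnegative coefficients. -/
def value (w : FiveType → ℝ≥0∞) (g : Series) : ℝ≥0∞ :=
  ∑' m, ENNReal.ofReal (MvPowerSeries.coeff m g) * monomialValue w m

theorem monomialValue_add (w : FiveType → ℝ≥0∞) (m n : FiveType →₀ ℕ) :
    monomialValue w (m + n) = monomialValue w m * monomialValue w n := by
  simp [monomialValue, pow_add, Finset.prod_mul_distrib]

theorem monomialValue_single (w : FiveType → ℝ≥0∞) (z : FiveType) (n : ℕ) :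
    monomialValue w (Finsupp.single z n) = w z ^ n := by
  rw [monomialValue, Finset.prod_eq_single z]
  · simp
  · intro t _ ht
    rw [Finsupp.single_eq_of_ne ht, pow_zero]
  · simp

variable {g h : Series} (w : FiveType → ℝ≥0∞)

theorem NonnegCoeff.add (hg : NonnegCoeff g) (hh : NonnegCoeff h) : NonnegCoeff (g + h) :=
  fun m => by rw [map_add]; exact add_nonneg (hg m) (hh m)

theorem NonnegCoeff.mul (hg : NonnegCoeff g) (hh : NonnegCoeff h) : NonnegCoeff (g * h) :=
  fun m => by
    rw [MvPowerSeries.coeff_mul]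
    exact Finset.sum_nonneg fun _ _ => mul_nonneg (hg _) (hh _)

theorem NonnegCoeff.C_mul {r : ℝ} (hr : 0 ≤ r) (hg : NonnegCoeff g) :
    NonnegCoeff (MvPowerSeries.C r * g) :=
  fun m => by rw [MvPowerSeries.coeff_C_mul]; exact mul_nonneg hr (hg m)

theorem nonnegCoeff_one : NonnegCoeff 1 := fun m => by
  classical
  rw [MvPowerSeries.coeff_one]; split_ifs <;> simp

theorem nonnegCoeff_X (z : FiveType) : NonnegCoeff (MvPowerSeries.X z) := fun m => by
  classical
  rw [MvPowerSeries.coeff_X]; split_ifs <;> simp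

theorem NonnegCoeff.pow (hg : NonnegCoeff g) (n : ℕ) : NonnegCoeff (g ^ n) := by
  induction n with
  | zero => rw [pow_zero]; exact nonnegCoeff_one
  | succ n ih => rw [pow_succ]; exact ih.mul hg

theorem nonnegCoeff_sum {ι : Type} (s : Finset ι) {G : ι → Series}
    (hG : ∀ i ∈ s, NonnegCoeff (G i)) : NonnegCoeff (∑ i ∈ s, G i) := fun m => by
  rw [map_sum]; exact Finset.sum_nonneg fun i hi => hG i hi m

theorem nonnegCoeff_oneVar (z : FiveType) {a : ℕ → ℝ} (ha : ∀ n, 0 ≤ a n) :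
    NonnegCoeff (oneVar z a) := fun m => by
  change 0 ≤ if m = Finsupp.single z (m z) then a (m z) else 0
  split_ifs
  · exact ha _
  · exact le_rfl

theorem value_add (hg : NonnegCoeff g) (hh : NonnegCoeff h) :
    value w (g + h) = value w g + value w h := by
  rw [value, value, value, ← ENNReal.tsum_add]
  refine tsum_congr fun m => ?_
  rw [map_add, ENNReal.ofReal_add (hg m) (hh m), add_mul]

theorem value_C_mul {r : ℝ} (hr : 0 ≤ r) (g : Series) :
    value w (MvPowerSeries.C r * g) = ENNReal.ofReal r * value w g := by
  rw [value, value, ← ENNReal.tsum_mul_left]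
  refine tsum_congr fun m => ?_
  rw [MvPowerSeries.coeff_C_mul, ENNReal.ofReal_mul hr, mul_assoc]

/-- Cauchy product. Nonnegativity lets `ENNReal.ofReal` pass through the sums of products, and sums
in `[0, ∞]` rearrange freely, so no convergence condition is needed. -/
theorem value_mul (hg : NonnegCoeff g) (hh : NonnegCoeff h) :
    value w (g * h) = value w g * value w h := by
  classical
  have h1 : value w (g * h) = ∑' m : FiveType →₀ ℕ, ∑' x : Finset.HasAntidiagonal.antidiagonal m,
      (ENNReal.ofReal (MvPowerSeries.coeff x.1.1 g) * monomialValue w x.1.1) *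
        (ENNReal.ofReal (MvPowerSeries.coeff x.1.2 h) * monomialValue w x.1.2) := by
    refine tsum_congr fun m => ?_
    rw [MvPowerSeries.coeff_mul, ENNReal.ofReal_sum_of_nonneg fun _ _ => mul_nonneg (hg _) (hh _),
      Finset.sum_mul, tsum_fintype, Finset.univ_eq_attach,
      Finset.sum_attach (Finset.HasAntidiagonal.antidiagonal m) fun x : (FiveType →₀ ℕ) × (FiveType →₀ ℕ) =>
        (ENNReal.ofReal (MvPowerSeries.coeff x.1 g) * monomialValue w x.1) *
        (ENNReal.ofReal (MvPowerSeries.coeff x.2 h) * monomialValue w x.2)]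
    refine Finset.sum_congr rfl fun x hx => ?_
    rw [← Finset.HasAntidiagonal.mem_antidiagonal.1 hx, monomialValue_add, ENNReal.ofReal_mul (hg _)]
    ring
  rw [h1, ← ENNReal.tsum_sigma' (f := fun x : (m : FiveType →₀ ℕ) × Finset.HasAntidiagonal.antidiagonal m =>
    (ENNReal.ofReal (MvPowerSeries.coeff x.2.1.1 g) * monomialValue w x.2.1.1) *
        (ENNReal.ofReal (MvPowerSeries.coeff x.2.1.2 h) * monomialValue w x.2.1.2))]
  have h2 := Finset.HasAntidiagonal.sigmaAntidiagonalEquivProd.tsum_eq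
    (fun x : (FiveType →₀ ℕ) × (FiveType →₀ ℕ) =>
      (ENNReal.ofReal (MvPowerSeries.coeff x.1 g) * monomialValue w x.1) *
        (ENNReal.ofReal (MvPowerSeries.coeff x.2 h) * monomialValue w x.2))
  refine Eq.trans h2 ?_
  rw [ENNReal.tsum_prod', value, value, ← ENNReal.tsum_mul_right]
  refine tsum_congr fun m => ?_
  dsimp only
  rw [ENNReal.tsum_mul_left]

theorem value_one : value w 1 = 1 := by
  classical
  rw [value, tsum_eq_single 0]
  · simp [monomialValue]
  · intro m hm
    rw [MvPowerSeries.coeff_one, if_neg hm]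
    simp

theorem value_X (z : FiveType) : value w (MvPowerSeries.X z) = w z := by
  classical
  rw [value, tsum_eq_single (Finsupp.single z 1)]
  · rw [MvPowerSeries.coeff_X, if_pos rfl, monomialValue_single]
    simp
  · intro m hm
    rw [MvPowerSeries.coeff_X, if_neg hm]
    simp

theorem value_pow (hg : NonnegCoeff g) (n : ℕ) : value w (g ^ n) = value w g ^ n := by
  induction n with
  | zero => rw [pow_zero, pow_zero, value_one]
  | succ n ih => rw [pow_succ, pow_succ, value_mul w (hg.pow n) hg, ih]

theorem value_sum {ι : Type} (s : Finset ι) {G : ι → Series} (hG : ∀ i ∈ s, NonnegCoeff (G i)) :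
    value w (∑ i ∈ s, G i) = ∑ i ∈ s, value w (G i) := by
  classical
  induction s using Finset.induction_on with
  | empty => simp [value]
  | insert a s ha ih =>
    have hs : ∀ i ∈ s, NonnegCoeff (G i) := fun i hi => hG i (Finset.mem_insert_of_mem hi)
    rw [Finset.sum_insert ha, Finset.sum_insert ha,
      value_add w (hG a (Finset.mem_insert_self a s)) (nonnegCoeff_sum s hs), ih hs]

theorem value_oneVar (z : FiveType) (a : ℕ → ℝ) :
    value w (oneVar z a) = ∑' n, ENNReal.ofReal (a n) * w z ^ n := by
  have hinj : Function.Injective fun n : ℕ => (Finsupp.single z n : FiveType →₀ ℕ) :=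
    Finsupp.single_injective z
  have hcoeff : ∀ m, MvPowerSeries.coeff m (oneVar z a) =
      if m = Finsupp.single z (m z) then a (m z) else 0 := fun _ => rfl
  rw [value, ← hinj.tsum_eq]
  · refine tsum_congr fun n => ?_
    rw [hcoeff, monomialValue_single]
    simp
  · intro m hm
    by_contra hcon
    refine hm ?_
    dsimp only
    rw [hcoeff, if_neg, ENNReal.ofReal_zero, zero_mul]
    exact fun h => hcon ⟨m z, h.symm⟩

theorem nonnegCoeff_expSeries {c : ℝ} (hc : 0 ≤ c) (z : FiveType) :
    NonnegCoeff (expSeries c z) := nonnegCoeff_oneVar z fun n => by positivity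

theorem nonnegCoeff_mixSeries {q : ℝ} (hq : 0 ≤ q) (hq1 : q ≤ 1) :
    NonnegCoeff (mixSeries q) :=
  ((nonnegCoeff_X _).C_mul hq).add ((nonnegCoeff_X _).C_mul (sub_nonneg.2 hq1))

theorem value_mixSeries {q : ℝ} (hq : 0 ≤ q) (hq1 : q ≤ 1) :
    value w (mixSeries q) =
      ENNReal.ofReal q * w .t010 + ENNReal.ofReal (1 - q) * w .t110 := by
  rw [mixSeries, value_add w ((nonnegCoeff_X _).C_mul hq)
    ((nonnegCoeff_X _).C_mul (sub_nonneg.2 hq1)), value_C_mul w hq,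
    value_C_mul w (sub_nonneg.2 hq1), value_X, value_X]

end Series

/-! ### Partial sums and tails of the exponential series -/

open scoped ENNReal

/-- The lower partial sums of the exponential series. -/
def expLower (c : ℝ) (m : ℕ) : ℝ := ∑ h ∈ Finset.range m, c ^ h / (h.factorial : ℝ)

/-- The tails of the exponential series. -/
def expUpper (c : ℝ) (m : ℕ) : ℝ := ∑' h : ℕ, if m ≤ h then c ^ h / (h.factorial : ℝ) else 0

theorem expLower_succ (c : ℝ) (m : ℕ) :
    expLower c (m + 1) = c ^ m / (m.factorial : ℝ) + expLower c m := by
  rw [expLower, Finset.sum_range_succ, add_comm]; rfl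

theorem expLower_nonneg {c : ℝ} (hc : 0 ≤ c) (m : ℕ) : 0 ≤ expLower c m :=
  Finset.sum_nonneg fun _ _ => by positivity

theorem expLower_pos {c : ℝ} (hc : 0 < c) {m : ℕ} (hm : 0 < m) : 0 < expLower c m :=
  Finset.sum_pos (fun _ _ => by positivity) ⟨0, by simpa using hm⟩

theorem summable_expUpper (c : ℝ) (m : ℕ) :
    Summable fun h : ℕ => if m ≤ h then c ^ h / (h.factorial : ℝ) else 0 :=
  ((Real.summable_pow_div_factorial c).indicator {h | m ≤ h}).congr fun h => by
    simp [Set.indicator_apply]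

theorem expUpper_succ (c : ℝ) (m : ℕ) :
    expUpper c m = c ^ m / (m.factorial : ℝ) + expUpper c (m + 1) := by
  rw [expUpper, (summable_expUpper c m).tsum_eq_add_tsum_ite m, if_pos le_rfl, expUpper]
  congr 1
  refine tsum_congr fun h => ?_
  by_cases h1 : h = m
  · simp [h1]
  · rw [if_neg h1]
    by_cases h2 : m ≤ h
    · rw [if_pos h2, if_pos (by omega)]
    · rw [if_neg h2, if_neg (by omega)]

theorem expUpper_nonneg {c : ℝ} (hc : 0 ≤ c) (m : ℕ) : 0 ≤ expUpper c m :=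
  tsum_nonneg fun h => by split_ifs <;> positivity

theorem expUpper_pos {c : ℝ} (hc : 0 < c) (m : ℕ) : 0 < expUpper c m := by
  rw [expUpper_succ]
  exact add_pos_of_pos_of_nonneg (by positivity) (expUpper_nonneg hc.le _)

namespace Series

variable (w : FiveType → ℝ≥0∞)

theorem nonnegCoeff_lowerSeries {c q : ℝ} (hc : 0 ≤ c) (hq : 0 ≤ q) (hq1 : q ≤ 1) (m : ℕ) :
    NonnegCoeff (lowerSeries c q m) :=
  (nonnegCoeff_sum _ fun h _ => ((nonnegCoeff_mixSeries hq hq1).pow h).C_mul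
    (by positivity)).C_mul (inv_nonneg.2 (expLower_nonneg hc m))

theorem value_lowerSeries {c q : ℝ} (hc : 0 ≤ c) (hq : 0 ≤ q) (hq1 : q ≤ 1) (m : ℕ) :
    value w (lowerSeries c q m) = ENNReal.ofReal (expLower c m)⁻¹ *
      ∑ h ∈ Finset.range m, ENNReal.ofReal (c ^ h / (h.factorial : ℝ)) *
        (ENNReal.ofReal q * w .t010 + ENNReal.ofReal (1 - q) * w .t110) ^ h := by
  have hmix := nonnegCoeff_mixSeries hq hq1
  rw [lowerSeries, ← expLower, value_C_mul w (inv_nonneg.2 (expLower_nonneg hc m)),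
    value_sum w _ fun h _ => (hmix.pow h).C_mul (by positivity)]
  congr 1
  refine Finset.sum_congr rfl fun h _ => ?_
  rw [value_C_mul w (by positivity), value_pow w hmix, value_mixSeries w hq hq1]

theorem nonnegCoeff_upperSeries {c : ℝ} (hc : 0 ≤ c) (m : ℕ) :
    NonnegCoeff (upperSeries c m) :=
  (nonnegCoeff_oneVar _ fun h => by split_ifs <;> positivity).C_mul
    (inv_nonneg.2 (expUpper_nonneg hc m))

theorem value_upperSeries {c : ℝ} (hc : 0 ≤ c) (m : ℕ) :
    value w (upperSeries c m) = ENNReal.ofReal (expUpper c m)⁻¹ *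
      ∑' h : ℕ, ENNReal.ofReal (if m ≤ h then c ^ h / (h.factorial : ℝ) else 0) *
        w .t111 ^ h := by
  rw [upperSeries, ← expUpper, value_C_mul w (inv_nonneg.2 (expUpper_nonneg hc m)), value_oneVar]

end Series

/-! ### Conditioned Poisson distributions -/

instance (c : ℝ) : IsProbabilityMeasure (po c) := by
  rw [po]; infer_instance

theorem po_singleton {c : ℝ} (hc : 0 ≤ c) (n : ℕ) :
    po c {n} = ENNReal.ofReal (Real.exp (-c) * c ^ n / n.factorial) := by
  rw [← ofReal_measureReal, po, poissonMeasure_real_singleton, Real.coe_toNNReal c hc]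

theorem po_apply {c : ℝ} (hc : 0 ≤ c) (A : Set ℕ) [DecidablePred (· ∈ A)] :
    po c A = ENNReal.ofReal
      (Real.exp (-c) * ∑' h : ℕ, if h ∈ A then c ^ h / (h.factorial : ℝ) else 0) := by
  have hs : Summable fun h : ℕ => if h ∈ A then c ^ h / (h.factorial : ℝ) else 0 :=
    (((Real.summable_pow_div_factorial c).indicator A).congr fun h => by
      simp [Set.indicator_apply])
  rw [← tsum_mul_left, ENNReal.ofReal_tsum_of_nonneg _ (hs.mul_left _)]
  · rw [← Measure.tsum_indicator_apply_singleton _ _ MeasurableSet.of_discrete]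
    refine tsum_congr fun h => ?_
    rw [Set.indicator_apply, po_singleton hc]
    split_ifs <;> simp [mul_div_assoc]
  · intro h
    split_ifs <;> positivity

theorem po_lower {c : ℝ} (hc : 0 ≤ c) (m : ℕ) :
    po c {n | n < m} = ENNReal.ofReal (Real.exp (-c) * expLower c m) := by
  rw [po_apply hc, tsum_eq_sum (s := Finset.range m)]
  · congr 2
    refine Finset.sum_congr rfl fun h hh => ?_
    exact if_pos (Finset.mem_range.1 hh)
  · intro h hh
    exact if_neg fun hcon => hh (Finset.mem_range.2 hcon)

theorem po_upper {c : ℝ} (hc : 0 ≤ c) (m : ℕ) :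
    po c {n | m ≤ n} = ENNReal.ofReal (Real.exp (-c) * expUpper c m) :=
  po_apply hc _

theorem po_lower_ne_zero {c : ℝ} (hc : 0 < c) {m : ℕ} (hm : 0 < m) : po c {n | n < m} ≠ 0 := by
  rw [po_lower hc.le]
  exact (ENNReal.ofReal_pos.2 (mul_pos (Real.exp_pos _) (expLower_pos hc hm))).ne'

theorem po_upper_ne_zero {c : ℝ} (hc : 0 < c) (m : ℕ) : po c {n | m ≤ n} ≠ 0 := by
  rw [po_upper hc.le]
  exact (ENNReal.ofReal_pos.2 (mul_pos (Real.exp_pos _) (expUpper_pos hc m))).ne'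

/-- Conditioning cancels the factor `exp (-c)` and leaves the weights of `lowerSeries`;
`cond_po_upper` is the counterpart for `upperSeries`. -/
theorem cond_po_lower {c : ℝ} (hc : 0 < c) {m : ℕ} (hm : 0 < m) (h : ℕ) :
    (po c)[|{n | n < m}] {h} =
      ENNReal.ofReal (if h < m then (expLower c m)⁻¹ * (c ^ h / (h.factorial : ℝ)) else 0) := by
  have hL := expLower_pos hc hm
  rw [cond_apply MeasurableSet.of_discrete]
  split_ifs with hh
  · rw [Set.inter_eq_right.2 (Set.singleton_subset_iff.2 (show h ∈ {n | n < m} from hh)), po_lower hc.le, po_singleton hc.le,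
      ← ENNReal.ofReal_inv_of_pos (by positivity), ← ENNReal.ofReal_mul (by positivity)]
    congr 1
    field_simp
  · have : {n | n < m} ∩ {h} = (∅ : Set ℕ) := by
      ext n; simp only [Set.mem_inter_iff, Set.mem_ofPred_eq, Set.mem_singleton_iff,
        Set.mem_empty_iff_false, iff_false]
      omega
    simp [this]

theorem cond_po_upper {c : ℝ} (hc : 0 < c) (m : ℕ) (h : ℕ) :
    (po c)[|{n | m ≤ n}] {h} =
      ENNReal.ofReal (if m ≤ h then (expUpper c m)⁻¹ * (c ^ h / (h.factorial : ℝ)) else 0) := by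
  have hL := expUpper_pos hc m
  rw [cond_apply MeasurableSet.of_discrete]
  split_ifs with hh
  · rw [Set.inter_eq_right.2 (Set.singleton_subset_iff.2 (show h ∈ {n | m ≤ n} from hh)), po_upper hc.le, po_singleton hc.le,
      ← ENNReal.ofReal_inv_of_pos (by positivity), ← ENNReal.ofReal_mul (by positivity)]
    congr 1
    field_simp
  · have : {n | m ≤ n} ∩ {h} = (∅ : Set ℕ) := by
      ext n; simp only [Set.mem_inter_iff, Set.mem_ofPred_eq, Set.mem_singleton_iff,
        Set.mem_empty_iff_false, iff_false]
      omega
    simp [this]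

theorem qVal_eq {d p : ℝ} (hc : 0 < d * p) (k : ℕ) :
    qVal d k p = (expUpper (d * p) (k - 1))⁻¹ * ((d * p) ^ (k - 1) / ((k - 1).factorial : ℝ)) := by
  have := expUpper_pos hc (k - 1)
  rw [qVal, measureReal_def, cond_po_upper hc, if_pos le_rfl, ENNReal.toReal_ofReal (by positivity)]

theorem qBar_eq {d p : ℝ} (hc : 0 < d * p) {k : ℕ} (hk : 2 ≤ k) :
    qBar d k p = (expLower (d * p) (k - 1))⁻¹ * ((d * p) ^ (k - 2) / ((k - 2).factorial : ℝ)) := by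
  have := expLower_pos hc (show 0 < k - 1 by omega)
  have hs : {n : ℕ | n ≤ k - 2} = {n | n < k - 1} := by
    ext n; simp only [Set.mem_ofPred_eq]; omega
  rw [qBar, hs, measureReal_def, cond_po_lower hc (by omega), if_pos (by omega),
    ENNReal.toReal_ofReal (by positivity)]

/-- Splitting the first term off the tail. This factor converts the normalisation over `h ≥ k - 1`
into that over `h ≥ k`; `one_sub_qBar` does the same for `h < k - 1` and `h < k - 2`. -/
theorem one_sub_qVal {d p : ℝ} (hc : 0 < d * p) {k : ℕ} (hk : 1 ≤ k) :
    1 - qVal d k p = (expUpper (d * p) (k - 1))⁻¹ * expUpper (d * p) k := by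
  have := expUpper_pos hc (k - 1)
  have h1 := expUpper_succ (d * p) (k - 1)
  rw [Nat.sub_add_cancel hk] at h1
  rw [qVal_eq hc, sub_eq_iff_eq_add, ← mul_add, add_comm, ← h1, inv_mul_cancel₀ this.ne']

theorem one_sub_qBar {d p : ℝ} (hc : 0 < d * p) {k : ℕ} (hk : 2 ≤ k) :
    1 - qBar d k p = (expLower (d * p) (k - 1))⁻¹ * expLower (d * p) (k - 2) := by
  have := expLower_pos hc (show 0 < k - 1 by omega)
  have h1 := expLower_succ (d * p) (k - 2)
  rw [show k - 2 + 1 = k - 1 by omega] at h1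
  rw [qBar_eq hc hk, sub_eq_iff_eq_add, ← mul_add, add_comm, ← h1, inv_mul_cancel₀ this.ne']

theorem qVal_nonneg (d : ℝ) (k : ℕ) (p : ℝ) : 0 ≤ qVal d k p := measureReal_nonneg

theorem qVal_le_one (d : ℝ) (k : ℕ) (p : ℝ) : qVal d k p ≤ 1 := measureReal_le_one

theorem qBar_nonneg (d : ℝ) (k : ℕ) (p : ℝ) : 0 ≤ qBar d k p := measureReal_nonneg

theorem qBar_le_one (d : ℝ) (k : ℕ) (p : ℝ) : qBar d k p ≤ 1 := measureReal_le_one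

end

noncomputable section

/-! ### From codes to isomorphism classes -/

/-- Forget the last generation. -/
def Code.forget {Y : Type} : (s : ℕ) → Code Y (s + 1) → Code Y s
  | 0, _ => ()
  | s + 1, c => (c.1, c.2.map (Code.forget s))

theorem BranchingSample.forget_code {X Y : Type} [Fintype X] [DecidableEq X]
    (ω : BranchingSample X) (m : Node X → Y) :
    ∀ (s : ℕ) (u : Node X), Code.forget s (ω.code m (s + 1) u) = ω.code m s u
  | 0, _ => rfl
  | s + 1, u => by
    refine Prod.ext rfl ?_
    change ((ω.children u).val.map (ω.code m (s + 1))).map (Code.forget s) =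
      (ω.children u).val.map (ω.code m s)
    rw [Multiset.map_map]
    exact Multiset.map_congr rfl fun v _ => forget_code ω m s v

namespace MarkedGraphClass

variable {Y : Type}

/-- An open set that contains `Γ` contains all classes with the same neighbourhoods of the root up
to some radius. -/
theorem exists_forall_truncate_eq_imp_mem {U : Set (MarkedGraphClass Y)} (hU : IsOpen U)
    {Γ : MarkedGraphClass Y} (hΓ : Γ ∈ U) :
    ∃ n, ∀ Γ', (∀ s < n, truncate s Γ' = truncate s Γ) → Γ' ∈ U := by
  -- The sets in which membership is always forced by finitely many truncations form a topology.
  -- Every `chi Γ₀ s` is continuous for it, so it is finer than the given coarsest one.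
  let τ : TopologicalSpace (MarkedGraphClass Y) :=
    { IsOpen := fun U => ∀ Γ ∈ U, ∃ n, ∀ Γ', (∀ s < n, truncate s Γ' = truncate s Γ) → Γ' ∈ U
      isOpen_univ := fun _ _ => ⟨0, fun _ _ => trivial⟩
      isOpen_inter := fun U V hU hV Γ hΓ => by
        obtain ⟨n, hn⟩ := hU Γ hΓ.1
        obtain ⟨n', hn'⟩ := hV Γ hΓ.2
        exact ⟨max n n', fun Γ' h => ⟨hn Γ' fun s hs => h s (lt_max_of_lt_left hs),
          hn' Γ' fun s hs => h s (lt_max_of_lt_right hs)⟩⟩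
      isOpen_sUnion := fun 𝒰 h𝒰 Γ hΓ => by
        obtain ⟨U, hU, hΓU⟩ := hΓ
        obtain ⟨n, hn⟩ := h𝒰 U hU Γ hΓU
        exact ⟨n, fun Γ' h => ⟨U, hU, hn Γ' h⟩⟩ }
  have hτ : τ ≤ instTopologicalSpace (Y := Y) := by
    refine le_iInf₂ (α := TopologicalSpace (MarkedGraphClass Y)) fun Γ₀ s => ?_
    rintro _ ⟨A, -, rfl⟩ Γ hΓ
    refine ⟨s + 1, fun Γ' h => ?_⟩
    have h1 : chi Γ₀ s Γ' = chi Γ₀ s Γ := by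
      rw [chi, chi, h s (Nat.lt_succ_self s)]
    rw [Set.mem_preimage, h1]
    exact hΓ
  exact hτ U hU Γ hΓ

section Codes

variable {Ω Ω' : Type} {G : Ω ⊕ Ω' → MarkedGraphClass Y} {c : (n : ℕ) → Ω ⊕ Ω' → Code Y n}

/-- The codes that force the class to lie in `U`. -/
def forcingCodes (G : Ω ⊕ Ω' → MarkedGraphClass Y) (c : (n : ℕ) → Ω ⊕ Ω' → Code Y n)
    (U : Set (MarkedGraphClass Y)) (n : ℕ) : Set (Code Y n) :=
  {κ | ∀ x, c n x = κ → ∀ Γ, (∀ s < n, truncate s Γ = truncate s (G x)) → Γ ∈ U}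

theorem truncate_eq_of_code_eq (hforget : ∀ n x, Code.forget n (c (n + 1) x) = c n x)
    (hG : ∀ n x x', c (n + 1) x = c (n + 1) x' → truncate n (G x) = truncate n (G x')) :
    ∀ (n : ℕ) (x x' : Ω ⊕ Ω'), c n x = c n x' →
      ∀ s < n, truncate s (G x) = truncate s (G x')
  | 0, _, _, _, s, hs => absurd hs (Nat.not_lt_zero s)
  | n + 1, x, x', h, s, hs => by
    rcases Nat.lt_succ_iff_lt_or_eq.1 hs with hs | rfl
    · refine truncate_eq_of_code_eq hforget hG n x x' ?_ s hs
      rw [← hforget n x, ← hforget n x', h]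
    · exact hG _ x x' h

/-- An open set may be an uncountable union of cylinders. Sorting sample points by a radius that
forces membership leaves a countable union of events on codes, which are discrete. Both sample
spaces are put into one sum so that the same sets of codes serve both processes. -/
theorem preimage_eq_iUnion_forcingCodes
    (hforget : ∀ n x, Code.forget n (c (n + 1) x) = c n x)
    (hG : ∀ n x x', c (n + 1) x = c (n + 1) x' → truncate n (G x) = truncate n (G x'))
    {U : Set (MarkedGraphClass Y)} (hU : IsOpen U) :
    G ⁻¹' U = ⋃ n, c n ⁻¹' forcingCodes G c U n := by
  ext x
  rw [Set.mem_iUnion]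
  constructor
  · intro hx
    obtain ⟨n, hn⟩ := exists_forall_truncate_eq_imp_mem hU hx
    refine ⟨n, fun x' hx' Γ hΓ => hn Γ fun s hs => ?_⟩
    rw [hΓ s hs, truncate_eq_of_code_eq hforget hG n x' x hx' s hs]
  · rintro ⟨n, hn⟩
    exact hn x rfl _ fun _ _ => rfl

theorem monotone_forcingCodes (hforget : ∀ n x, Code.forget n (c (n + 1) x) = c n x)
    (U : Set (MarkedGraphClass Y)) : Monotone fun n => c n ⁻¹' forcingCodes G c U n := by
  refine monotone_nat_of_le_succ fun n x hx x' hx' Γ hΓ => ?_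
  refine hx x' ?_ Γ fun s hs => hΓ s (Nat.lt_succ_of_lt hs)
  rw [← hforget n x, ← hforget n x', hx']

theorem measurable_of_measurable_code {α : Type} [MeasurableSpace α] (j : α → Ω ⊕ Ω')
    (hforget : ∀ n x, Code.forget n (c (n + 1) x) = c n x)
    (hG : ∀ n x x', c (n + 1) x = c (n + 1) x' → truncate n (G x) = truncate n (G x'))
    (hc : ∀ n, Measurable fun a => c n (j a)) : Measurable fun a => G (j a) := by
  refine measurable_of_isOpen fun U hU => ?_
  have h1 : (fun a => G (j a)) ⁻¹' U = j ⁻¹' (G ⁻¹' U) := rfl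
  rw [h1, preimage_eq_iUnion_forcingCodes hforget hG hU, Set.preimage_iUnion]
  exact MeasurableSet.iUnion fun n => hc n MeasurableSet.of_discrete

/-- Two random classes with the same distributions of codes are identically distributed. -/
theorem identDistrib_of_code [MeasurableSpace Ω] [MeasurableSpace Ω'] {μ : Measure Ω}
    {ν : Measure Ω'} [IsProbabilityMeasure μ] [IsProbabilityMeasure ν]
    (hforget : ∀ n x, Code.forget n (c (n + 1) x) = c n x)
    (hG : ∀ n x x', c (n + 1) x = c (n + 1) x' → truncate n (G x) = truncate n (G x'))
    (hc : ∀ n, Measurable fun ω => c n (Sum.inl ω)) (hc' : ∀ n, Measurable fun ω => c n (Sum.inr ω))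
    (hlaw : ∀ (n : ℕ) (K : Set (Code Y n)), μ {ω | c n (Sum.inl ω) ∈ K} = ν {ω | c n (Sum.inr ω) ∈ K}) :
    IdentDistrib (fun ω => G (Sum.inl ω)) (fun ω => G (Sum.inr ω)) μ ν := by
  have hm := measurable_of_measurable_code Sum.inl hforget hG hc
  have hm' := measurable_of_measurable_code Sum.inr hforget hG hc'
  refine ⟨hm.aemeasurable, hm'.aemeasurable, ?_⟩
  have := Measure.isProbabilityMeasure_map (μ := μ) hm.aemeasurable
  have := Measure.isProbabilityMeasure_map (μ := ν) hm'.aemeasurable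
  refine ext_of_generate_finite {U | IsOpen U} rfl isPiSystem_isOpen (fun U hU => ?_) (by simp)
  have hU' : IsOpen U := hU
  rw [Measure.map_apply hm hU'.measurableSet, Measure.map_apply hm' hU'.measurableSet]
  have h1 : (fun ω => G (Sum.inl ω)) ⁻¹' U =
      ⋃ n, {ω | c n (Sum.inl ω) ∈ forcingCodes G c U n} := by
    change Sum.inl ⁻¹' (G ⁻¹' U) = _
    rw [preimage_eq_iUnion_forcingCodes hforget hG hU', Set.preimage_iUnion]
    rfl
  have h2 : (fun ω => G (Sum.inr ω)) ⁻¹' U =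
      ⋃ n, {ω | c n (Sum.inr ω) ∈ forcingCodes G c U n} := by
    change Sum.inr ⁻¹' (G ⁻¹' U) = _
    rw [preimage_eq_iUnion_forcingCodes hforget hG hU', Set.preimage_iUnion]
    rfl
  -- The code events increase with `n`, so continuity from below reduces the claim to the law of the
  -- code at each fixed `n`.
  have hmono := monotone_forcingCodes (G := G) hforget U
  have hmono₁ : Monotone fun n => {ω | c n (Sum.inl ω) ∈ forcingCodes G c U n} :=
    fun _ _ h _ hω => hmono h hω
  have hmono₂ : Monotone fun n => {ω | c n (Sum.inr ω) ∈ forcingCodes G c U n} :=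
    fun _ _ h _ hω => hmono h hω
  rw [h1, h2, hmono₁.measure_iUnion, hmono₂.measure_iUnion]
  simp_rw [hlaw]

end Codes

end MarkedGraphClass
end

noncomputable section

open scoped ENNReal NNReal

/-! ### The fixed point is positive -/

theorem exists_lt_mul_of_coreThreshold_lt {k : ℕ} {d : ℝ} (hd : coreThreshold k < d) :
    ∃ l : ℝ, 0 < l ∧ 0 < d ∧ l < d * (po l).real {n | k - 1 ≤ n} := by
  obtain ⟨_, ⟨l, hl, rfl⟩, h⟩ := exists_lt_of_csInf_lt
    (Set.Nonempty.image _ ⟨1, Set.mem_Ioi.2 one_pos⟩) hd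
  have hl' : 0 < l := hl
  have hP : 0 < (po l).real {n | k - 1 ≤ n} :=
    ENNReal.toReal_pos (po_upper_ne_zero hl' _) (measure_ne_top _ _)
  refine ⟨l, hl', lt_trans (div_pos hl' hP) h, ?_⟩
  exact (div_lt_iff₀ hP).1 h

theorem continuous_phi (d : ℝ) (k : ℕ) : Continuous (phi d k) := by
  rw [show phi d k = _ from funext (phi_eq d k)]
  fun_prop

/-- Some `l > 0` satisfies `l / P[Po(l) ≥ k - 1] < d`, that is `φ(l/d) > l/d`. As `φ(1) ≤ 1`, the
intermediate value theorem gives a fixed point in `[l/d, 1]`. -/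
theorem pStar_pos {k : ℕ} (hk : 2 ≤ k) {d : ℝ} (hd : coreThreshold k < d) : 0 < pStar d k := by
  obtain ⟨l, hl, hd0, h⟩ := exists_lt_mul_of_coreThreshold_lt hd
  have hphi : phi d k (l / d) = (po l).real {n | k - 1 ≤ n} := by
    rw [phi, mul_div_cancel₀ _ hd0.ne']
  have hlt : l / d < phi d k (l / d) := by
    rw [hphi, div_lt_iff₀ hd0, mul_comm]; exact h
  have hle : l / d ≤ 1 := hlt.le.trans (by rw [hphi]; exact measureReal_le_one)
  have h1 : phi d k 1 ≤ 1 := measureReal_le_one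
  have hcont : ContinuousOn (fun p => p - phi d k p) (Set.Icc (l / d) 1) :=
    (continuous_id.sub (continuous_phi d k)).continuousOn
  obtain ⟨p, hp, hp0⟩ := intermediate_value_Icc hle hcont
    (show (0 : ℝ) ∈ Set.Icc (l / d - phi d k (l / d)) (1 - phi d k 1) from
      ⟨by linarith, by linarith⟩)
  have hpos : 0 < l / d := div_pos hl hd0
  refine lt_of_lt_of_le (lt_of_lt_of_le hpos hp.1) ((pStar_isGreatest d k hk).2
    ⟨⟨hpos.le.trans hp.1, hp.2⟩, ?_⟩)
  dsimp only at hp0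
  linarith

/-! ### The two-type process -/

/-- The top-down messages and the marks of the two-type process as a decoration. -/
def messageDecoration (k : ℕ) : Decoration Bool Bool (Bool × Bool × Bool) where
  -- A child of type `1` subtracts its own upward message from the sum. The guard handles indices
  -- that are not children, for which `Finset.erase` removes nothing.
  step b _ y a := decide (k - 1 ≤ b.toNat + (y true - if a.2 < y a.1 then a.1.toNat else 0))
  mark b z y := (decide (k ≤ b.toNat + y true), z, b)

theorem sum_upMsg_children (ω : BranchingSample Bool) (u : Node Bool) :
    ∑ w ∈ ω.children u, (upMsg ω w).toNat = ω.offspring u true := by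
  rw [BranchingSample.children_eq, Finset.sum_map, kids, Finset.sum_map, Finset.sum_sigma]
  change ∑ x : Bool, ∑ i ∈ Finset.range (ω.offspring u x), x.toNat = ω.offspring u true
  simp

theorem sum_upMsg_erase (ω : BranchingSample Bool) (u : Node Bool) (a : Bool × ℕ) :
    ∑ w ∈ (ω.children u).erase (a :: u), (upMsg ω w).toNat =
      ω.offspring u true - if a.2 < ω.offspring u a.1 then a.1.toNat else 0 := by
  split_ifs with h
  · have h1 := Finset.sum_erase_add (ω.children u) (fun w => (upMsg ω w).toNat)
      ((ω.mem_children u a).2 h)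
    rw [sum_upMsg_children] at h1
    have h2 : upMsg ω (a :: u) = a.1 := rfl
    rw [h2] at h1
    omega
  · rw [Finset.erase_eq_of_notMem (fun hm => h ((ω.mem_children u a).1 hm)), sum_upMsg_children]
    rfl

theorem state_messageDecoration (k : ℕ) (ω : BranchingSample Bool) :
    ∀ u : Node Bool, (messageDecoration k).state ω false u = downMsg k ω u
  | [] => rfl
  | a :: u => by
    rw [Decoration.state, downMsg, sum_upMsg_erase, state_messageDecoration k ω u]
    rfl

theorem label_messageDecoration (k : ℕ) (ω : BranchingSample Bool) :
    (messageDecoration k).label ω false =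
      fun v => (vertexMark k ω v, upMsg ω v, downMsg k ω v) := by
  funext u
  rw [Decoration.label, state_messageDecoration, vertexMark, sum_upMsg_children]
  rfl

/-- The distribution of the number of children of type `1`. -/
def typeOneOffspring (d : ℝ) (k : ℕ) (p : ℝ) (z : Bool) : Measure ℕ :=
  if z = true then (po (d * p))[|{n | k - 1 ≤ n}] else (po (d * p))[|{n | n < k - 1}]

theorem isProbabilityMeasure_typeOneOffspring {d p : ℝ} (hc : 0 < d * p) {k : ℕ} (hk : 2 ≤ k)
    (z : Bool) : IsProbabilityMeasure (typeOneOffspring d k p z) := by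
  rw [typeOneOffspring]
  split_ifs
  · exact cond_isProbabilityMeasure (po_upper_ne_zero hc _)
  · exact cond_isProbabilityMeasure (po_lower_ne_zero hc (by omega))

theorem isProbabilityMeasure_twoTypeOffspring {d p : ℝ} (hc : 0 < d * p) {k : ℕ} (hk : 2 ≤ k)
    (z : Bool) : IsProbabilityMeasure (twoTypeOffspring d k p z) := by
  rw [twoTypeOffspring]
  have : ∀ b : Bool, IsProbabilityMeasure (match b with
      | false => po (d * (1 - p))
      | true => if z = true then (po (d * p))[|{n | k - 1 ≤ n}]
        else (po (d * p))[|{n | n < k - 1}]) := by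
    rintro (_ | _)
    · exact inferInstanceAs (IsProbabilityMeasure (po _))
    · exact isProbabilityMeasure_typeOneOffspring hc hk z
  infer_instance

theorem twoTypeOffspring_singleton {d p : ℝ} (hc : 0 < d * p) {k : ℕ} (hk : 2 ≤ k) (z : Bool)
    (y : Bool → ℕ) : twoTypeOffspring d k p z {y} =
      typeOneOffspring d k p z {y true} * po (d * (1 - p)) {y false} := by
  rw [twoTypeOffspring]
  have : ∀ b : Bool, IsProbabilityMeasure (match b with
      | false => po (d * (1 - p))
      | true => if z = true then (po (d * p))[|{n | k - 1 ≤ n}]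
        else (po (d * p))[|{n | n < k - 1}]) := by
    rintro (_ | _)
    · exact inferInstanceAs (IsProbabilityMeasure (po _))
    · exact isProbabilityMeasure_typeOneOffspring hc hk z
  rw [Measure.pi_singleton, Fintype.prod_bool]
  rfl

theorem tsum_boolArrow (F : (Bool → ℕ) → ℝ≥0∞) :
    ∑' y, F y = ∑' h : ℕ, ∑' n : ℕ, F fun b => bif b then h else n := by
  rw [← (Equiv.boolArrowEquivProd ℕ).symm.tsum_eq F, ENNReal.tsum_prod', ENNReal.tsum_comm]
  refine tsum_congr fun h => tsum_congr fun n => congrArg F ?_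
  funext b
  cases b <;> rfl

/-- The probability generating function of the Poisson distribution. -/
def poissonPgf (c : ℝ) (x : ℝ≥0∞) : ℝ≥0∞ := ∑' n : ℕ, po c {n} * x ^ n

theorem coe_genFunctional {Y C : Type} (g : Y → ℝ≥0) (f : C → ℝ≥0) (e : Y × Multiset C) :
    ((genFunctional g f e : ℝ≥0) : ℝ≥0∞) =
      (g e.1 : ℝ≥0∞) * (e.2.map fun c => (f c : ℝ≥0∞)).prod := by
  rw [genFunctional, ENNReal.coe_mul]
  congr 1
  have := map_multiset_prod ENNReal.ofNNRealHom (e.2.map f)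
  rw [Multiset.map_map] at this
  exact this

/-- The recursion for the generating functionals of the two-type process. -/
theorem lintegral_codeLaw_messageDecoration {d p : ℝ} (hc : 0 < d * p) {k : ℕ} (hk : 2 ≤ k)
    [∀ z, IsProbabilityMeasure (twoTypeOffspring d k p z)] (b z : Bool) (s : ℕ)
    (g : Bool × Bool × Bool → ℝ≥0) (f : Code (Bool × Bool × Bool) s → ℝ≥0) {x : Bool → Bool → ℝ≥0∞}
    (hx : ∀ z b, x z b = ∫⁻ c, f c ∂(messageDecoration k).codeLaw (twoTypeOffspring d k p) b s z) :
    ∫⁻ e : (Bool × Bool × Bool) × Multiset (Code (Bool × Bool × Bool) s), genFunctional g f e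
        ∂(messageDecoration k).codeLaw (twoTypeOffspring d k p) b (s + 1) z =
      ∑' h : ℕ, typeOneOffspring d k p z {h} * (g (decide (k ≤ b.toNat + h), z, b) *
        (x true (decide (k - 1 ≤ b.toNat + (h - 1))) ^ h *
          poissonPgf (d * (1 - p)) (x false (decide (k - 1 ≤ b.toNat + h))))) := by
  simp_rw [coe_genFunctional]
  refine ((messageDecoration k).lintegral_codeLaw_succ (twoTypeOffspring d k p) b s z
    (fun m => (g m : ℝ≥0∞)) (fun c => (f c : ℝ≥0∞))).trans ?_
  rw [tsum_boolArrow]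
  refine tsum_congr fun h => ?_
  rw [poissonPgf, ← ENNReal.tsum_mul_left, ← ENNReal.tsum_mul_left, ← ENNReal.tsum_mul_left]
  refine tsum_congr fun n => ?_
  rw [twoTypeOffspring_singleton hc hk, Fintype.prod_bool]
  -- The state of a child depends only on its type and on `h`, so the children of each type
  -- contribute a power. For `h = 0` the truncated `h - 1` in the state is irrelevant, because the
  -- exponent is `0`.
  have h1 : ∀ i ∈ Finset.range h, ∫⁻ c, f c ∂(messageDecoration k).codeLaw
      (twoTypeOffspring d k p) ((messageDecoration k).step b z (fun b => bif b then h else n)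
        (true, i)) s true = x true (decide (k - 1 ≤ b.toNat + (h - 1))) := by
    intro i hi
    rw [hx]
    simp [messageDecoration, Finset.mem_range.1 hi]
  have h2 : ∀ i ∈ Finset.range n, ∫⁻ c, f c ∂(messageDecoration k).codeLaw
      (twoTypeOffspring d k p) ((messageDecoration k).step b z (fun b => bif b then h else n)
        (false, i)) s false = x false (decide (k - 1 ≤ b.toNat + h)) := by
    intro i hi
    rw [hx]
    simp [messageDecoration]
  have h3 := Finset.prod_congr rfl h1
  have h4 := Finset.prod_congr rfl h2
  rw [Finset.prod_const, Finset.card_range] at h3 h4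
  simp only [cond_true, cond_false]
  rw [h3, h4]
  simp only [messageDecoration, cond_true]
  ring

/-! ### The five-type process -/

/-- The marks of the five-type process as a decoration. -/
def typeDecoration : Decoration FiveType Unit (Bool × Bool × Bool) where
  step _ _ _ _ := ()
  mark _ z _ := z.bits

theorem nonnegCoeff_genFun {d p : ℝ} (hc : 0 ≤ d * p) (hc' : 0 ≤ d * (1 - p)) (k : ℕ)
    (z : FiveType) : Series.NonnegCoeff (genFun d k p z) := by
  have hq := qVal_nonneg d k p
  have hq1 := qVal_le_one d k p
  have hE := Series.nonnegCoeff_expSeries hc'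
  have hm := Series.nonnegCoeff_mixSeries hq hq1
  have hL := Series.nonnegCoeff_lowerSeries hc hq hq1
  have hU := Series.nonnegCoeff_upperSeries hc
  cases z
  · exact (hE _).mul (hL _)
  · exact (((hE _).mul (hm.pow _)).C_mul (qBar_nonneg d k p)).add
      (((hE _).mul (hL _)).C_mul (sub_nonneg.2 (qBar_le_one d k p)))
  · exact (hE _).mul (hm.pow _)
  · exact (hE _).mul (hU _)
  · exact (hE _).mul (hU _)

theorem value_expSeries {c : ℝ} (hc : 0 ≤ c) (w : FiveType → ℝ≥0∞) (z : FiveType) :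
    Series.value w (expSeries c z) = poissonPgf c (w z) := by
  rw [expSeries, Series.value_oneVar, poissonPgf]
  exact tsum_congr fun n => by rw [po_singleton hc]

theorem value_genFun_t000 {d p : ℝ} (hc : 0 ≤ d * p) (hc' : 0 ≤ d * (1 - p)) (k : ℕ)
    (w : FiveType → ℝ≥0∞) {m : ℝ≥0∞}
    (hm : m = ENNReal.ofReal (qVal d k p) * w .t010 + ENNReal.ofReal (1 - qVal d k p) * w .t110) :
    Series.value w (genFun d k p .t000) =
    poissonPgf (d * (1 - p)) (w .t000) * (ENNReal.ofReal (expLower (d * p) (k - 1))⁻¹ *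
      ∑ h ∈ Finset.range (k - 1), ENNReal.ofReal ((d * p) ^ h / (h.factorial : ℝ)) * m ^ h) := by
  have hq := qVal_nonneg d k p
  have hq1 := qVal_le_one d k p
  rw [genFun, Series.value_mul w (Series.nonnegCoeff_expSeries hc' _)
    (Series.nonnegCoeff_lowerSeries hc hq hq1 _), value_expSeries hc',
    Series.value_lowerSeries w hc hq hq1, hm]

theorem value_genFun_t010 {d p : ℝ} (hc' : 0 ≤ d * (1 - p)) (k : ℕ)
    (w : FiveType → ℝ≥0∞) {m : ℝ≥0∞}
    (hm : m = ENNReal.ofReal (qVal d k p) * w .t010 + ENNReal.ofReal (1 - qVal d k p) * w .t110) :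
    Series.value w (genFun d k p .t010) =
    poissonPgf (d * (1 - p)) (w .t001) * m ^ (k - 1) := by
  have hmix := Series.nonnegCoeff_mixSeries (qVal_nonneg d k p) (qVal_le_one d k p)
  rw [genFun, Series.value_mul w (Series.nonnegCoeff_expSeries hc' _) (hmix.pow _),
    value_expSeries hc', Series.value_pow w hmix,
    Series.value_mixSeries w (qVal_nonneg d k p) (qVal_le_one d k p), hm]

theorem value_genFun_t001 {d p : ℝ} (hc : 0 ≤ d * p) (hc' : 0 ≤ d * (1 - p)) (k : ℕ)
    (w : FiveType → ℝ≥0∞) {m : ℝ≥0∞}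
    (hm : m = ENNReal.ofReal (qVal d k p) * w .t010 + ENNReal.ofReal (1 - qVal d k p) * w .t110) :
    Series.value w (genFun d k p .t001) =
    ENNReal.ofReal (qBar d k p) * (poissonPgf (d * (1 - p)) (w .t001) * m ^ (k - 2)) +
    ENNReal.ofReal (1 - qBar d k p) * (poissonPgf (d * (1 - p)) (w .t000) *
      (ENNReal.ofReal (expLower (d * p) (k - 2))⁻¹ *
        ∑ h ∈ Finset.range (k - 2), ENNReal.ofReal ((d * p) ^ h / (h.factorial : ℝ)) * m ^ h)) := by
  have hq := qVal_nonneg d k p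
  have hq1 := qVal_le_one d k p
  have hb := qBar_nonneg d k p
  have hb1 := sub_nonneg.2 (qBar_le_one d k p)
  have hE := Series.nonnegCoeff_expSeries hc'
  have hmix := Series.nonnegCoeff_mixSeries hq hq1
  have hL := Series.nonnegCoeff_lowerSeries hc hq hq1
  rw [genFun, Series.value_add w (((hE _).mul (hmix.pow _)).C_mul hb)
    (((hE _).mul (hL _)).C_mul hb1), Series.value_C_mul w hb, Series.value_C_mul w hb1,
    Series.value_mul w (hE _) (hmix.pow _), Series.value_mul w (hE _) (hL _), value_expSeries hc',
    value_expSeries hc', Series.value_pow w hmix, Series.value_mixSeries w hq hq1,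
    Series.value_lowerSeries w hc hq hq1, hm]

theorem value_expSeries_mul_upperSeries {c c' : ℝ} (hc : 0 ≤ c) (hc' : 0 ≤ c') (j : ℕ)
    (w : FiveType → ℝ≥0∞) :
    Series.value w (expSeries c' .t001 * upperSeries c j) =
    poissonPgf c' (w .t001) * (ENNReal.ofReal (expUpper c j)⁻¹ *
      ∑' h : ℕ, ENNReal.ofReal (if j ≤ h then c ^ h / (h.factorial : ℝ) else 0) *
        w .t111 ^ h) := by
  rw [Series.value_mul w (Series.nonnegCoeff_expSeries hc' _)
    (Series.nonnegCoeff_upperSeries hc _), value_expSeries hc', Series.value_upperSeries w hc]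

theorem fiveTypeOffspring_singleton (d : ℝ) (k : ℕ) (p : ℝ) (z : FiveType) (y : FiveType → ℕ) :
    fiveTypeOffspring d k p z {y} = ENNReal.ofReal (offspringProb d k p z y) := by
  rw [fiveTypeOffspring, Measure.sum_smul_dirac_singleton]

/-- Reindexing from functions to finitely supported functions: integrating a product of weights of
the children is evaluating the generating function at these weights. With all weights `1` it
computes the total mass. -/
theorem tsum_fiveTypeOffspring (d : ℝ) (k : ℕ) (p : ℝ) (z : FiveType) (w : FiveType → ℝ≥0∞) :
    ∑' y : FiveType → ℕ, fiveTypeOffspring d k p z {y} * ∏ t, w t ^ y t =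
      Series.value w (genFun d k p z) := by
  rw [Series.value, ← Equiv.tsum_eq (Finsupp.equivFunOnFinite (α := FiveType) (M := ℕ)).symm]
  refine tsum_congr fun y => ?_
  rw [fiveTypeOffspring_singleton]
  rfl

/-- The recursion for the generating functionals of the five-type process. -/
theorem lintegral_codeLaw_typeDecoration {d p : ℝ} {k : ℕ}
    [∀ z, IsProbabilityMeasure (fiveTypeOffspring d k p z)] (z : FiveType) (s : ℕ)
    (g : Bool × Bool × Bool → ℝ≥0) (f : Code (Bool × Bool × Bool) s → ℝ≥0)
    {w : FiveType → ℝ≥0∞}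
    (hw : ∀ z, w z = ∫⁻ c, f c ∂typeDecoration.codeLaw (fiveTypeOffspring d k p) () s z) :
    ∫⁻ e : (Bool × Bool × Bool) × Multiset (Code (Bool × Bool × Bool) s), genFunctional g f e
        ∂typeDecoration.codeLaw (fiveTypeOffspring d k p) () (s + 1) z =
      g z.bits * Series.value w (genFun d k p z) := by
  simp_rw [coe_genFunctional]
  refine (typeDecoration.lintegral_codeLaw_succ (fiveTypeOffspring d k p) () s z
    (fun m => (g m : ℝ≥0∞)) (fun c => (f c : ℝ≥0∞))).trans ?_
  rw [← tsum_fiveTypeOffspring, ← ENNReal.tsum_mul_left]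
  refine tsum_congr fun y => ?_
  have h1 : ∀ t : FiveType, ∏ i ∈ Finset.range (y t), ∫⁻ c, f c ∂typeDecoration.codeLaw
      (fiveTypeOffspring d k p) (typeDecoration.step () z y (t, i)) s t = w t ^ y t := by
    intro t
    rw [hw]
    simp [typeDecoration]
  simp_rw [h1]
  simp only [typeDecoration]
  ring

end

noncomputable section

open scoped ENNReal NNReal

/-! ### Comparison of the two processes -/

theorem tsum_typeOneOffspring_false {d p : ℝ} (hc : 0 < d * p) {k : ℕ} (hk : 2 ≤ k)
    (Φ : ℕ → ℝ≥0∞) :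
    ∑' h : ℕ, typeOneOffspring d k p false {h} * Φ h =
      ∑ h ∈ Finset.range (k - 1), ENNReal.ofReal (expLower (d * p) (k - 1))⁻¹ *
        (ENNReal.ofReal ((d * p) ^ h / (h.factorial : ℝ)) * Φ h) := by
  have hL := expLower_pos hc (show 0 < k - 1 by omega)
  have h1 : ∀ h, typeOneOffspring d k p false {h} = ENNReal.ofReal (if h < k - 1 then
      (expLower (d * p) (k - 1))⁻¹ * ((d * p) ^ h / (h.factorial : ℝ)) else 0) :=
    cond_po_lower hc (by omega)
  rw [tsum_eq_sum (s := Finset.range (k - 1))]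
  · refine Finset.sum_congr rfl fun h hh => ?_
    rw [h1, if_pos (Finset.mem_range.1 hh), ENNReal.ofReal_mul (by positivity), mul_assoc]
  · intro h hh
    rw [h1, if_neg fun hcon => hh (Finset.mem_range.2 hcon), ENNReal.ofReal_zero, zero_mul]

theorem tsum_typeOneOffspring_true {d p : ℝ} (hc : 0 < d * p) (k : ℕ) (Φ : ℕ → ℝ≥0∞) :
    ∑' h : ℕ, typeOneOffspring d k p true {h} * Φ h =
      ENNReal.ofReal (expUpper (d * p) (k - 1))⁻¹ * ∑' h : ℕ,
        ENNReal.ofReal (if k - 1 ≤ h then (d * p) ^ h / (h.factorial : ℝ) else 0) * Φ h := by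
  have hU := expUpper_pos hc (k - 1)
  have h1 : ∀ h, typeOneOffspring d k p true {h} = ENNReal.ofReal (if k - 1 ≤ h then
      (expUpper (d * p) (k - 1))⁻¹ * ((d * p) ^ h / (h.factorial : ℝ)) else 0) :=
    cond_po_upper hc (k - 1)
  rw [← ENNReal.tsum_mul_left]
  refine tsum_congr fun h => ?_
  rw [h1]
  split_ifs
  · rw [ENNReal.ofReal_mul (by positivity), mul_assoc]
  · simp

/-- Isolates `h = k - 1`, which produces the type `010`, from `h ≥ k`, which produces `110`. -/
theorem tsum_upper_split (c : ℝ) {k : ℕ} (hk : 1 ≤ k) (Φ : ℕ → ℝ≥0∞) :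
    ∑' h : ℕ, ENNReal.ofReal (if k - 1 ≤ h then c ^ h / (h.factorial : ℝ) else 0) * Φ h =
      ENNReal.ofReal (c ^ (k - 1) / ((k - 1).factorial : ℝ)) * Φ (k - 1) +
      ∑' h : ℕ, ENNReal.ofReal (if k ≤ h then c ^ h / (h.factorial : ℝ) else 0) * Φ h := by
  rw [ENNReal.tsum_eq_add_tsum_ite (k - 1), if_pos le_rfl]
  congr 1
  refine tsum_congr fun h => ?_
  by_cases h1 : h = k - 1
  · rw [if_pos h1, if_neg (by omega), ENNReal.ofReal_zero, zero_mul]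
  · rw [if_neg h1]
    by_cases h2 : k ≤ h
    · rw [if_pos h2, if_pos (by omega)]
    · rw [if_neg h2, if_neg (by omega)]

theorem ofReal_qVal_add (d : ℝ) (k : ℕ) (p : ℝ) :
    ENNReal.ofReal (qVal d k p) + ENNReal.ofReal (1 - qVal d k p) = 1 := by
  rw [← ENNReal.ofReal_add (qVal_nonneg d k p) (sub_nonneg.2 (qVal_le_one d k p))]
  simp

theorem ofReal_qBar_add (d : ℝ) (k : ℕ) (p : ℝ) :
    ENNReal.ofReal (qBar d k p) + ENNReal.ofReal (1 - qBar d k p) = 1 := by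
  rw [← ENNReal.ofReal_add (qBar_nonneg d k p) (sub_nonneg.2 (qBar_le_one d k p))]
  simp

theorem poissonPgf_one (c : ℝ) : poissonPgf c 1 = 1 := by
  have h := Measure.tsum_indicator_apply_singleton (po c) Set.univ MeasurableSet.univ
  simpa [poissonPgf] using h

theorem lower_total_mass {c : ℝ} (hc : 0 < c) {m : ℕ} (hm : 0 < m) :
    ENNReal.ofReal (expLower c m)⁻¹ *
      ∑ h ∈ Finset.range m, ENNReal.ofReal (c ^ h / (h.factorial : ℝ)) = 1 := by
  have hL := expLower_pos hc hm
  rw [← ENNReal.ofReal_sum_of_nonneg fun h _ => by positivity,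
    ← ENNReal.ofReal_mul (by positivity), ← expLower, inv_mul_cancel₀ hL.ne', ENNReal.ofReal_one]

theorem upper_total_mass {c : ℝ} (hc : 0 < c) (m : ℕ) :
    ENNReal.ofReal (expUpper c m)⁻¹ *
      ∑' h : ℕ, ENNReal.ofReal (if m ≤ h then c ^ h / (h.factorial : ℝ) else 0) = 1 := by
  have hU := expUpper_pos hc m
  rw [← ENNReal.ofReal_tsum_of_nonneg (fun h => by split_ifs <;> positivity)
    (summable_expUpper c m), ← ENNReal.ofReal_mul (by positivity), ← expUpper,
    inv_mul_cancel₀ hU.ne', ENNReal.ofReal_one]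

/-- Every factor is a probability generating function, hence `1` at `1`. The type `001` needs `k ≥
3`, since its sum over `h < k - 2` must be nonempty. -/
theorem value_genFun_one {d p : ℝ} (hc : 0 < d * p) (hc' : 0 ≤ d * (1 - p)) {k : ℕ} (hk : 3 ≤ k)
    (z : FiveType) : Series.value (fun _ => 1) (genFun d k p z) = 1 := by
  have hm : (1 : ℝ≥0∞) = ENNReal.ofReal (qVal d k p) * (fun _ : FiveType => 1) FiveType.t010 +
      ENNReal.ofReal (1 - qVal d k p) * (fun _ : FiveType => 1) FiveType.t110 := by
    simp only [mul_one, ofReal_qVal_add]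
  cases z
  · rw [value_genFun_t000 hc.le hc' k _ hm]
    simp only [one_pow, mul_one, poissonPgf_one, one_mul]
    exact lower_total_mass hc (by omega)
  · rw [value_genFun_t001 hc.le hc' k _ hm]
    simp only [one_pow, mul_one, poissonPgf_one, one_mul]
    rw [lower_total_mass hc (by omega), mul_one, ofReal_qBar_add]
  · rw [value_genFun_t010 hc' k _ hm]
    simp only [one_pow, mul_one, poissonPgf_one]
  · rw [genFun, value_expSeries_mul_upperSeries hc.le hc']
    simp only [one_pow, mul_one, poissonPgf_one, one_mul]
    exact upper_total_mass hc _
  · rw [genFun, value_expSeries_mul_upperSeries hc.le hc']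
    simp only [one_pow, mul_one, poissonPgf_one, one_mul]
    exact upper_total_mass hc _

theorem isProbabilityMeasure_fiveTypeOffspring {d p : ℝ} (hc : 0 < d * p) (hc' : 0 ≤ d * (1 - p))
    {k : ℕ} (hk : 3 ≤ k) (z : FiveType) : IsProbabilityMeasure (fiveTypeOffspring d k p z) := by
  constructor
  rw [← Measure.tsum_indicator_apply_singleton _ _ MeasurableSet.univ,
    ← value_genFun_one hc hc' hk z, ← tsum_fiveTypeOffspring]
  simp

/-- The laws of the codes of the two processes agree, where the type and the state of the root of
the two-type process correspond to one type or to a mixture of two types. -/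
structure CodeLawsAgree (d : ℝ) (k : ℕ) (p : ℝ) (s : ℕ) : Prop where
  zero_zero : (messageDecoration k).codeLaw (twoTypeOffspring d k p) false s false =
    typeDecoration.codeLaw (fiveTypeOffspring d k p) () s .t000
  zero_one : (messageDecoration k).codeLaw (twoTypeOffspring d k p) true s false =
    typeDecoration.codeLaw (fiveTypeOffspring d k p) () s .t001
  one_zero : (messageDecoration k).codeLaw (twoTypeOffspring d k p) false s true =
    ENNReal.ofReal (qVal d k p) • typeDecoration.codeLaw (fiveTypeOffspring d k p) () s .t010 +
    ENNReal.ofReal (1 - qVal d k p) • typeDecoration.codeLaw (fiveTypeOffspring d k p) () s .t110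
  one_one : (messageDecoration k).codeLaw (twoTypeOffspring d k p) true s true =
    typeDecoration.codeLaw (fiveTypeOffspring d k p) () s .t111

section Comparison

variable {d p : ℝ} {k : ℕ} [∀ z, IsProbabilityMeasure (twoTypeOffspring d k p z)]
  [∀ z, IsProbabilityMeasure (fiveTypeOffspring d k p z)]

theorem codeLaw_zero_ext {Y : Type} {μ ν : Measure (Code Y 0)}
    (h : μ Set.univ = ν Set.univ) : μ = ν := by
  have : Subsingleton (Code Y 0) := inferInstanceAs (Subsingleton Unit)
  ext s _
  rcases s.eq_empty_or_nonempty with rfl | hs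
  · simp
  · rw [Subsingleton.eq_univ_of_nonempty hs, h]

theorem codeLawsAgree_zero : CodeLawsAgree d k p 0 where
  zero_zero := codeLaw_zero_ext (by simp)
  zero_one := codeLaw_zero_ext (by simp)
  one_zero := codeLaw_zero_ext (by simp [ofReal_qVal_add])
  one_one := codeLaw_zero_ext (by simp)

theorem codeLaw_ext {Y : Type} [Countable Y] {s : ℕ} {μ ν : Measure (Code Y (s + 1))}
    [IsFiniteMeasure μ] [IsFiniteMeasure ν]
    (h : ∀ (g : Y → ℝ≥0) (f : Code Y s → ℝ≥0),
      ∫⁻ e : Y × Multiset (Code Y s), genFunctional g f e ∂μ =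
      ∫⁻ e : Y × Multiset (Code Y s), genFunctional g f e ∂ν) : μ = ν := by
  let _ : MeasurableSpace (Y × Multiset (Code Y s)) := Code.instMeasurableSpace Y (s + 1)
  have : DiscreteMeasurableSpace (Y × Multiset (Code Y s)) :=
    Code.instDiscreteMeasurableSpace Y (s + 1)
  exact @Measure.ext_of_genFunctional Y (Code Y s) _ _ _ _ μ ν ‹_› ‹_› fun g f _ _ => h g f

theorem lintegral_smul_add_smul {α : Type} [MeasurableSpace α] (a b : ℝ≥0∞) (μ ν : Measure α)
    (F : α → ℝ≥0∞) : ∫⁻ e, F e ∂(a • μ + b • ν) = a * ∫⁻ e, F e ∂μ + b * ∫⁻ e, F e ∂ν := by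
  rw [lintegral_add_measure, lintegral_smul_measure, lintegral_smul_measure, smul_eq_mul,
    smul_eq_mul]

/-- Equality of generating functionals suffices. By `h10`, a child of type `1` with message `0`
contributes exactly the mixture `m`, because its mark is revealed only by its own offspring. It
remains to read off marks and messages from `h` and to match the normalising constants. -/
theorem codeLawsAgree_succ (hc : 0 < d * p) (hc' : 0 ≤ d * (1 - p)) (hk : 3 ≤ k) {s : ℕ}
    (ih : CodeLawsAgree d k p s) : CodeLawsAgree d k p (s + 1) := by
  let x (f : Code (Bool × Bool × Bool) s → ℝ≥0) (z b : Bool) : ℝ≥0∞ :=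
    ∫⁻ c, f c ∂(messageDecoration k).codeLaw (twoTypeOffspring d k p) b s z
  let w (f : Code (Bool × Bool × Bool) s → ℝ≥0) (z : FiveType) : ℝ≥0∞ :=
    ∫⁻ c, f c ∂typeDecoration.codeLaw (fiveTypeOffspring d k p) () s z
  have h00 : ∀ f, x f false false = w f .t000 := fun f => by simp only [x, w, ih.zero_zero]
  have h01 : ∀ f, x f false true = w f .t001 := fun f => by simp only [x, w, ih.zero_one]
  have h11 : ∀ f, x f true true = w f .t111 := fun f => by simp only [x, w, ih.one_one]
  have h10 : ∀ f, x f true false = ENNReal.ofReal (qVal d k p) * w f .t010 +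
      ENNReal.ofReal (1 - qVal d k p) * w f .t110 := fun f => by
    simp only [x, w, ih.one_zero, lintegral_smul_add_smul]
  have hL2 := expLower_pos hc (show 0 < k - 2 by omega)
  have hL1 := expLower_pos hc (show 0 < k - 1 by omega)
  have hU1 := expUpper_pos hc (k - 1)
  have hU := expUpper_pos hc k
  have two := fun b z g f => lintegral_codeLaw_messageDecoration hc (by omega) b z s g f
    (x := x f) fun _ _ => rfl
  have five := fun z g f => lintegral_codeLaw_typeDecoration (d := d) (p := p) (k := k) z s g f
    (w := w f) fun _ => rfl
  refine ⟨?_, ?_, ?_, ?_⟩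
  -- Type `0`, message `0`: as `h ≤ k - 2`, the mark and all messages to children are `0`.
  · refine codeLaw_ext fun g f => ?_
    rw [two, five, tsum_typeOneOffspring_false hc (by omega),
      value_genFun_t000 hc.le hc' k _ (h10 f), ← Finset.mul_sum]
    simp_rw [Finset.mul_sum]
    refine Finset.sum_congr rfl fun h hh => ?_
    have hh' := Finset.mem_range.1 hh
    rw [decide_eq_false (show ¬ k ≤ false.toNat + h by simp; omega),
      decide_eq_false (show ¬ k - 1 ≤ false.toNat + (h - 1) by simp; omega),
      decide_eq_false (show ¬ k - 1 ≤ false.toNat + h by simp; omega), h00, FiveType.bits]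
    ring
  -- Type `0`, message `1`: the mark and the messages to children of type `1` are `0`, while
  -- children of type `0` receive `1` only for `h = k - 2`, the last term, which carries `q̄`. At `h
  -- = 0` the truncated `h - 1` still gives message `0`, because `k ≥ 3`.
  · refine codeLaw_ext fun g f => ?_
    rw [two, five, tsum_typeOneOffspring_false hc (by omega),
      value_genFun_t001 hc.le hc' k _ (h10 f), mul_add,
      show Finset.range (k - 1) = Finset.range (k - 2 + 1) by congr 1; omega,
      Finset.sum_range_succ, add_comm]
    congr 1
    · rw [decide_eq_false (show ¬ k ≤ true.toNat + (k - 2) by simp; omega),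
        decide_eq_false (show ¬ k - 1 ≤ true.toNat + (k - 2 - 1) by simp; omega),
        decide_eq_true (show k - 1 ≤ true.toNat + (k - 2) by simp; omega), h01, FiveType.bits,
        qBar_eq hc (by omega), ENNReal.ofReal_mul (by positivity)]
      ring
    · simp_rw [Finset.mul_sum]
      refine Finset.sum_congr rfl fun h hh => ?_
      have hh' := Finset.mem_range.1 hh
      have hq : ENNReal.ofReal (expLower (d * p) (k - 1))⁻¹ =
          ENNReal.ofReal (1 - qBar d k p) * ENNReal.ofReal (expLower (d * p) (k - 2))⁻¹ := by
        rw [one_sub_qBar hc (by omega), ← ENNReal.ofReal_mul (by positivity)]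
        congr 1
        field_simp
      rw [decide_eq_false (show ¬ k ≤ true.toNat + h by simp; omega),
        decide_eq_false (show ¬ k - 1 ≤ true.toNat + (h - 1) by simp; omega),
        decide_eq_false (show ¬ k - 1 ≤ true.toNat + h by simp; omega), h00, FiveType.bits, hq]
      ring
  -- Type `1`, message `0`: children of type `0` always receive `1`. For `h = k - 1` the mark and
  -- the messages to children of type `1` are `0`; for `h ≥ k` they are `1`.
  · have : IsFiniteMeasure (ENNReal.ofReal (qVal d k p) •
        typeDecoration.codeLaw (fiveTypeOffspring d k p) () (s + 1) .t010 +
        ENNReal.ofReal (1 - qVal d k p) •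
          typeDecoration.codeLaw (fiveTypeOffspring d k p) () (s + 1) .t110) :=
      ⟨by simp [ofReal_qVal_add]⟩
    refine codeLaw_ext fun g f => ?_
    refine (two _ _ _ _).trans (Eq.trans ?_ (lintegral_smul_add_smul _ _ _ _ _).symm)
    refine Eq.trans ?_ (congrArg₂ (fun u v => ENNReal.ofReal (qVal d k p) * u +
      ENNReal.ofReal (1 - qVal d k p) * v) (five _ _ _).symm (five _ _ _).symm)
    rw [tsum_typeOneOffspring_true hc, value_genFun_t010 hc' k _ (h10 f), genFun,
      value_expSeries_mul_upperSeries hc.le hc', tsum_upper_split _ (by omega), mul_add]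
    congr 1
    · rw [decide_eq_false (show ¬ k ≤ false.toNat + (k - 1) by simp; omega),
        decide_eq_false (show ¬ k - 1 ≤ false.toNat + (k - 1 - 1) by simp; omega),
        decide_eq_true (show k - 1 ≤ false.toNat + (k - 1) by simp), h01, FiveType.bits,
        qVal_eq hc, ENNReal.ofReal_mul (by positivity)]
      ring
    · have hq : ENNReal.ofReal (expUpper (d * p) (k - 1))⁻¹ =
          ENNReal.ofReal (1 - qVal d k p) * ENNReal.ofReal (expUpper (d * p) k)⁻¹ := by
        rw [one_sub_qVal hc (by omega), ← ENNReal.ofReal_mul (by positivity)]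
        congr 1
        field_simp
      simp_rw [hq, ← ENNReal.tsum_mul_left]
      refine tsum_congr fun h => ?_
      by_cases hh : k ≤ h
      · rw [decide_eq_true (show k ≤ false.toNat + h by simpa using hh),
          decide_eq_true (show k - 1 ≤ false.toNat + (h - 1) by simp; omega),
          decide_eq_true (show k - 1 ≤ false.toNat + h by simp; omega), h01, h11, FiveType.bits]
        ring
      · simp [hh]
  -- Type `1`, message `1`: at least `k` messages `1` come in, so the mark is `1`, and at least `k -
  -- 1` remain without any one child, so all messages to children are `1`.
  · refine codeLaw_ext fun g f => ?_
    rw [two, five, tsum_typeOneOffspring_true hc, genFun,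
      value_expSeries_mul_upperSeries hc.le hc']
    simp_rw [← ENNReal.tsum_mul_left]
    refine tsum_congr fun h => ?_
    by_cases hh : k - 1 ≤ h
    · rw [decide_eq_true (show k ≤ true.toNat + h by simp; omega),
        decide_eq_true (show k - 1 ≤ true.toNat + (h - 1) by simp; omega),
        decide_eq_true (show k - 1 ≤ true.toNat + h by simp; omega), h01, h11, FiveType.bits]
      ring
    · simp [hh]

theorem codeLawsAgree (hc : 0 < d * p) (hc' : 0 ≤ d * (1 - p)) (hk : 3 ≤ k) :
    ∀ s, CodeLawsAgree d k p s
  | 0 => codeLawsAgree_zero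
  | s + 1 => codeLawsAgree_succ hc hc' hk (codeLawsAgree hc hc' hk s)

end Comparison

/-! ### The law of the code of the whole tree -/

namespace Decoration

variable {X S Y : Type} [Fintype X] [DecidableEq X] [MeasurableSpace X]
  [DiscreteMeasurableSpace X] [Countable Y] (D : Decoration X S Y)

/-- The code of the first `s` generations of the tree. -/
def treeCode (b : S) (s : ℕ) (ω : BranchingSample X) : Code Y s :=
  ω.code (D.label ω b) s []

theorem measurable_treeCode (b : S) (s : ℕ) : Measurable (D.treeCode b s) :=
  measurable_from_prod_countable_right fun z => D.measurable_rootCode s b z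

theorem branchingLaw_treeCode (root : Measure X) [SFinite root] (off : X → Measure (X → ℕ))
    [∀ z, IsProbabilityMeasure (off z)] (b : S) (s : ℕ) (K : Set (Code Y s)) :
    branchingLaw root off {ω | D.treeCode b s ω ∈ K} =
      ∫⁻ z, D.codeLaw off b s z K ∂root := by
  have hm : MeasurableSet {ω | D.treeCode b s ω ∈ K} :=
    D.measurable_treeCode b s MeasurableSet.of_discrete
  rw [branchingLaw, Measure.prod_apply hm]
  refine lintegral_congr fun z => ?_
  rw [codeLaw, Measure.map_apply (D.measurable_rootCode s b z) MeasurableSet.of_discrete]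
  rfl

end Decoration

/-! ### Total masses and the equality of the laws of the trees -/

theorem isProbabilityMeasure_branchingLaw {X : Type} [MeasurableSpace X] (root : Measure X)
    [IsProbabilityMeasure root] (off : X → Measure (X → ℕ)) [∀ z, IsProbabilityMeasure (off z)] :
    IsProbabilityMeasure (branchingLaw root off) := by
  rw [branchingLaw]
  infer_instance

theorem isProbabilityMeasure_twoTypeRoot {p : ℝ} (hp : 0 ≤ p) (hp1 : p ≤ 1) :
    IsProbabilityMeasure (twoTypeRoot p) := by
  constructor
  simp only [twoTypeRoot, Measure.coe_add, Measure.coe_smul, Pi.add_apply, Pi.smul_apply,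
    measure_univ, smul_eq_mul, mul_one]
  rw [← ENNReal.ofReal_add hp (sub_nonneg.2 hp1)]
  simp

theorem isProbabilityMeasure_fiveTypeRoot {p : ℝ} (hp : 0 ≤ p) (hp1 : p ≤ 1) (d : ℝ) (k : ℕ) :
    IsProbabilityMeasure (fiveTypeRoot d k p) := by
  constructor
  simp only [fiveTypeRoot, Measure.coe_add, Measure.coe_smul, Pi.add_apply, Pi.smul_apply,
    measure_univ, smul_eq_mul, mul_one]
  rw [ENNReal.ofReal_mul hp, ENNReal.ofReal_mul hp, add_assoc, ← mul_add, ofReal_qVal_add, mul_one,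
    ← ENNReal.ofReal_add (sub_nonneg.2 hp1) hp]
  simp

/-- The root receives message `0`, so only `zero_zero` and `one_zero` enter; the weights of the
latter split the root probability `p` into `p q` and `p (1 - q)`. -/
theorem branchingLaw_treeCode_eq {d p : ℝ} {k : ℕ} (hp : 0 ≤ p) (hp1 : p ≤ 1)
    [∀ z, IsProbabilityMeasure (twoTypeOffspring d k p z)]
    [∀ z, IsProbabilityMeasure (fiveTypeOffspring d k p z)] {s : ℕ}
    (h : CodeLawsAgree d k p s) (K : Set (Code (Bool × Bool × Bool) s)) :
    branchingLaw (twoTypeRoot p) (twoTypeOffspring d k p)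
        {ω | (messageDecoration k).treeCode false s ω ∈ K} =
      branchingLaw (fiveTypeRoot d k p) (fiveTypeOffspring d k p)
        {ω | typeDecoration.treeCode () s ω ∈ K} := by
  have : DiscreteMeasurableSpace FiveType := ⟨fun _ => trivial⟩
  have := isProbabilityMeasure_twoTypeRoot hp hp1
  have := isProbabilityMeasure_fiveTypeRoot hp hp1 d k
  rw [Decoration.branchingLaw_treeCode, Decoration.branchingLaw_treeCode, twoTypeRoot,
    fiveTypeRoot]
  simp only [lintegral_add_measure, lintegral_smul_measure, lintegral_dirac, smul_eq_mul,
    h.zero_zero, h.one_zero, Measure.coe_add, Measure.coe_smul, Pi.add_apply, Pi.smul_apply]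
  rw [ENNReal.ofReal_mul hp, ENNReal.ofReal_mul hp]
  ring

theorem BranchingSample.truncate_mk_eq_of_code_eq {X X' Y : Type} [Fintype X] [DecidableEq X]
    [Fintype X'] [DecidableEq X'] (ω : BranchingSample X) (ω' : BranchingSample X')
    {m : Node X → Y} {m' : Node X' → Y} {s : ℕ}
    (h : ω.code m (s + 1) [] = ω'.code m' (s + 1) []) :
    MarkedGraphClass.truncate s (.mk (ω.toMarkedGraph m)) =
      MarkedGraphClass.truncate s (.mk (ω'.toMarkedGraph m')) :=
  Quotient.sound (truncate_isomorphic_of_code_eq ω ω' h)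

theorem mainTheorem4 (k : ℕ) (hk : 3 ≤ k) (d : ℝ) (hd : coreThreshold k < d) :
    IsProbabilityMeasure (twoTypeLaw d k) ∧
    (∀ z y, 0 ≤ offspringProb d k (pStar d k) z y) ∧
    IsProbabilityMeasure (fiveTypeLaw d k (pStar d k)) ∧
    IdentDistrib
      (fun ω => MarkedGraphClass.mk (decoratedTree k ω))
      (fun ω => MarkedGraphClass.mk (fiveTypeTree ω))
      (twoTypeLaw d k) (fiveTypeLaw d k (pStar d k)) := by
  have hp := pStar_pos (show 2 ≤ k by omega) hd
  have hp1 : pStar d k ≤ 1 := (pStar_isGreatest d k (by omega)).1.1.2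
  obtain ⟨-, -, hd0, -⟩ := exists_lt_mul_of_coreThreshold_lt hd
  have hc : 0 < d * pStar d k := mul_pos hd0 hp
  have hc' : 0 ≤ d * (1 - pStar d k) := mul_nonneg hd0.le (sub_nonneg.2 hp1)
  have := isProbabilityMeasure_twoTypeOffspring hc (show 2 ≤ k by omega)
  have := isProbabilityMeasure_fiveTypeOffspring hc hc' hk
  have := isProbabilityMeasure_twoTypeRoot hp.le hp1
  have := isProbabilityMeasure_fiveTypeRoot hp.le hp1 d k
  have : DiscreteMeasurableSpace FiveType := ⟨fun _ => trivial⟩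
  have h2 : IsProbabilityMeasure (twoTypeLaw d k) := isProbabilityMeasure_branchingLaw _ _
  have h5 : IsProbabilityMeasure (fiveTypeLaw d k (pStar d k)) :=
    isProbabilityMeasure_branchingLaw _ _
  refine ⟨h2, fun z y => nonnegCoeff_genFun hc.le hc' k z _, h5, ?_⟩
  -- `G` and `c` live on the disjoint union of the sample spaces, so that codes are compared both
  -- within and across the two processes.
  let G : BranchingSample Bool ⊕ BranchingSample FiveType →
      MarkedGraphClass (Bool × Bool × Bool) :=
    Sum.elim (fun ω => .mk (ω.toMarkedGraph ((messageDecoration k).label ω false)))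
      fun ω => .mk (ω.toMarkedGraph (typeDecoration.label ω ()))
  let c (n : ℕ) : BranchingSample Bool ⊕ BranchingSample FiveType →
      Code (Bool × Bool × Bool) n :=
    Sum.elim ((messageDecoration k).treeCode false n) (typeDecoration.treeCode () n)
  have key : IdentDistrib (fun ω => G (Sum.inl ω)) (fun ω => G (Sum.inr ω))
      (twoTypeLaw d k) (fiveTypeLaw d k (pStar d k)) := by
    refine MarkedGraphClass.identDistrib_of_code (c := c) ?_ ?_
      (fun n => Decoration.measurable_treeCode _ _ n)
      (fun n => Decoration.measurable_treeCode _ _ n)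
      fun n K => branchingLaw_treeCode_eq hp.le hp1 (codeLawsAgree hc hc' hk n) K
    · rintro n (ω | ω) <;> exact BranchingSample.forget_code _ _ n []
    · rintro n (ω | ω) (ω' | ω') h <;> exact BranchingSample.truncate_mk_eq_of_code_eq _ _ h
  have hG : ∀ ω, G (Sum.inl ω) = MarkedGraphClass.mk (decoratedTree k ω) := fun ω => by
    simp only [G, Sum.elim_inl, label_messageDecoration]
    rfl
  simp_rw [hG] at key
  exact key

end
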